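/- Consider equivalence relations on the sets $[1,n]=\{1,\dots,n\}$, $n\ge 1$; the *length* $|\rho|$ of an equivalence relation $\rho$ on $[1,n]$ is $n$. Write $\sigma\le\rho$ (consecutive embedding) if there is $k\ge 0$ such that $k+|\sigma|\le|\rho|$ and, for all $i,j\in[1,|\sigma|]$, $(i,j)\in\sigma$ if and only if $(k+i,k+j)\in\rho$. For $1\le i\le j\le|\rho|$ let $\rho[i,j]$ be the restriction of $\rho$ to $\{i,\dots,j\}$, relabelled order-isomorphically to $[1,j-i+1]$. Let $B$ be a nonempty finite set of such equivalence relations, $b=\max\{|\rho|:\rho\in B\}$, and $C=\operatorname{Av}(B)$ the set of all equivalence relations $\sigma$ with $\beta\not\le\sigma$ for every $\beta\in B$. Let $C_b$ be the set of members of $C$ of length $b$, and assume that $C_b\neq\emptyset$. The set $C$ is *atomic* if it is not the union of two downward closed proper subsets. The *factor graph* $\Gamma_B$ is the digraph (loops allowed) with vertex set $C_b$ and with an edge $(\mu,\nu)$ exactly when the restriction of $\mu$ to $\{2,\dots,b\}$ and the restriction of $\nu$ to $\{1,\dots,b-1\}$ are isomorphic by the shift $x\mapsto x-1$. It is *strongly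 connected* if for any two vertices $u,v$ there is a path (possibly of length $0$) from $u$ to $v$. A digraph is a *bicycle* if its vertices and edges are exactly those of two disjoint simple cycles, an initial and a terminal one, together with a simple path from a vertex of the initial cycle to a vertex of the terminal cycle, no other vertex of which lies in either cycle; either or both cycles may be empty (then the corresponding end of the path is unconstrained), if one of them is empty the path may be absent, and if neither is empty the path has length at least one. (Loops count as simple cycles of length one.) A vertex $\nu$ of $\Gamma_B$ is *ambiguous* if $\{b\}$ is a class of $\nu$ and there are an edge $(\mu,\nu)$ of $\Gamma_B$ and a $\sigma\in C$ of length $n\ge b$ such that some class of $\sigma$ contains none of the largest $b-1$ points of $\sigma$, and the path $\sigma[1,b]\to\sigma[2,b+1]\to\dots\to\sigma[n-b+1,n]$ in $\Gamma_B$ ends at $\mu$. **Theorem.** $C=\operatorname{Av}(B)$ is atomic if and only if both of the following hold: 1. for every $\sigma\in C$ of length less than $b$ there is $\rho\in C_b$ with $\sigma\le\rho$; 2. $\Gamma_B$ is strongly connected, or $\Gamma_B$ is a bicycle that has no ambiguous vertices. -/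

import Mathlib

namespace ConsEq

/-! ## Downward closed sets, avoidance sets, atomicity -/

/-- The avoidance set of `B`: the elements that lie above no element of `B`. -/
def Av {X : Type*} [PartialOrder X] (B : Set X) : Set X :=
  {x | ∀ y ∈ B, ¬ y ≤ x}

theorem isLowerSet_Av {X : Type*} [PartialOrder X] (B : Set X) : IsLowerSet (Av B) :=
  fun _ _ hyx hx z hz hzy => hx z hz (hzy.trans hyx)

/-- A downward closed set `C` is atomic if it is not the union of two downward closed proper
subsets. -/
def IsAtomicSet {X : Type*} [PartialOrder X] (C : Set X) : Prop :=
  ¬ ∃ D E : Set X, IsLowerSet D ∧ IsLowerSet E ∧ D ⊂ C ∧ E ⊂ C ∧ C = D ∪ E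

/-! ## Finite equivalence relations under the consecutive embedding order -/

/-- An equivalence relation on a nonempty initial segment of the naturals with its natural
linear order: `Fin n` stands for `{1, …, n}`, so `i : Fin n` is the `(i + 1)`-st point.
Every equivalence relation on a nonempty finite linearly ordered set is isomorphic, by the unique
contiguous bijection, to exactly one of these. -/
@[ext]
structure EqRel where
  /-- the number of points -/
  length : ℕ
  pos : 0 < length
  /-- the equivalence relation -/
  rel : Setoid (Fin length)

/-- A map is contiguous if it sends the points, in order, to consecutive points. -/
def IsContiguous {m n : ℕ} (f : Fin m → Fin n) : Prop :=
  ∃ k : ℕ, ∀ i : Fin m, (f i : ℕ) = k + i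

/-- The consecutive embedding relation. -/
def Embeds (σ τ : EqRel) : Prop :=
  ∃ f : Fin σ.length → Fin τ.length,
    IsContiguous f ∧ ∀ i j, σ.rel i j ↔ τ.rel (f i) (f j)

theorem Embeds.length_le {σ τ : EqRel} (h : Embeds σ τ) : σ.length ≤ τ.length := by
  obtain ⟨f, ⟨k, hk⟩, -⟩ := h
  have h1 := hk ⟨σ.length - 1, by have := σ.pos; omega⟩
  have h2 := (f ⟨σ.length - 1, by have := σ.pos; omega⟩).isLt
  simp only at h1
  omega

theorem Embeds.antisymm {σ τ : EqRel} (h : Embeds σ τ) (h' : Embeds τ σ) : σ = τ := by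
  have hlen := le_antisymm h.length_le h'.length_le
  obtain ⟨f, ⟨k, hk⟩, hf⟩ := h
  obtain ⟨n, hn, r⟩ := σ
  obtain ⟨m, hm, s⟩ := τ
  simp only at hlen f hk hf
  subst hlen
  have h1 := hk ⟨n - 1, by omega⟩
  have h2 := (f ⟨n - 1, by omega⟩).isLt
  simp only at h1
  have hk0 : k = 0 := by omega
  have hid : ∀ i, f i = i := fun i => Fin.ext (by rw [hk i, hk0]; omega)
  have hrs : r = s := Setoid.ext fun i j => by simpa [hid] using hf i j
  subst hrs
  rfl

/-- The poset of finite equivalence relations under the consecutive embedding order. -/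
instance : PartialOrder EqRel where
  le := Embeds
  le_refl σ := ⟨id, ⟨0, fun i => by simp⟩, fun _ _ => Iff.rfl⟩
  le_trans := by
    rintro σ τ υ ⟨f, ⟨k, hk⟩, hf⟩ ⟨g, ⟨l, hl⟩, hg⟩
    refine ⟨g ∘ f, ⟨l + k, fun i => ?_⟩, fun i j => (hf i j).trans (hg _ _)⟩
    simp only [Function.comp_apply]
    rw [hl, hk, add_assoc]
  le_antisymm _ _ h h' := h.antisymm h'

/-- The restriction of an equivalence relation on `{1, …, n}` to the points `k + 1, …, k + m`,
relabelled as an equivalence relation on `{1, …, m}`. -/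
def restrict {n : ℕ} (r : Setoid (Fin n)) (k m : ℕ) (h : k + m ≤ n) : Setoid (Fin m) :=
  r.comap fun i => ⟨k + i, by omega⟩

/-! ## Digraphs (loops are allowed) -/

/-- There is a path (possibly of length zero) from any vertex to any vertex. -/
def StronglyConnected {V : Type*} (G : Digraph V) : Prop :=
  ∀ u v : V, Relation.ReflTransGen G.Adj u v

/-- `(u, v)` is one of the edges of the path `v₁ → ⋯ → vₖ` given by the list `p`. -/
def PathEdge {V : Type*} (p : List V) (u v : V) : Prop :=
  [u, v] <:+: p

/-- `(u, v)` is one of the edges of the closed path `v₁ → ⋯ → vₖ → v₁` given by the list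
`c = [v₁, …, vₖ]`. For `c = [v]` this is the loop at `v`, for `c = []` there is no edge. -/
def CycleEdge {V : Type*} (c : List V) (u v : V) : Prop :=
  PathEdge (c ++ c.head?.toList) u v

/-- The digraph `G` consists of an initial simple cycle `c` and a terminal simple cycle `d`,
disjoint and each possibly empty, and a connecting simple path `p` that starts in `c` and ends
in `d` and has no further vertex in a cycle. The empty list `p` is an absent path; if neither
cycle is empty, then `p` has length at least one, that is, at least two vertices. -/
def IsBicycle {V : Type*} (G : Digraph V) : Prop :=
  ∃ c p d : List V,
    c.Nodup ∧ p.Nodup ∧ d.Nodup ∧ c.Disjoint d ∧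
    (∀ v ∈ p, v ∈ c ↔ c ≠ [] ∧ p.head? = some v) ∧
    (∀ v ∈ p, v ∈ d ↔ d ≠ [] ∧ p.getLast? = some v) ∧
    (c ≠ [] → d ≠ [] → 2 ≤ p.length) ∧
    (∀ v : V, v ∈ c ∨ v ∈ p ∨ v ∈ d) ∧
    (∀ u v : V, G.Adj u v ↔ CycleEdge c u v ∨ PathEdge p u v ∨ CycleEdge d u v)

/-! ## The factor graph and ambiguous vertices -/

/-- The number `b`, the maximum length of an element of the (nonempty) finite set `B`. -/
def maxLength (B : Finset EqRel) : ℕ :=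
  B.sup EqRel.length

/-- The set `C_b` of the members of length `b` of `C = Av(B)`. -/
def level (B : Finset EqRel) : Set EqRel :=
  {σ | σ ∈ Av (B : Set EqRel) ∧ σ.length = maxLength B}

/-- The factor graph of `Av(B)`: its vertices are the members of length `b`, and `(μ, ν)` is an
edge if the restriction of `μ` to its last `b - 1` points is isomorphic to the restriction of `ν`
to its first `b - 1` points. -/
def factorGraph (B : Finset EqRel) : Digraph (level B) where
  Adj μ ν :=
    ∃ (hμ : 1 + (maxLength B - 1) ≤ μ.1.length) (hν : 0 + (maxLength B - 1) ≤ ν.1.length),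
      restrict μ.1.rel 1 (maxLength B - 1) hμ = restrict ν.1.rel 0 (maxLength B - 1) hν

/-- The list of all restrictions of `ρ` to `b` consecutive points, from left to right, relabelled
as equivalence relations on `{1, …, b}`. For `ρ ∈ Av(B)` of length at least `b` this is the
associated path in the factor graph of `Av(B)`. -/
def windows (ρ : EqRel) (b : ℕ) (hb : 0 < b) (h : b ≤ ρ.length) : List EqRel :=
  List.ofFn fun i : Fin (ρ.length - b + 1) => ⟨b, hb, restrict ρ.rel i b (by omega)⟩

/-- The largest point of `ν` is alone in its class. -/
def IsSpecial (ν : EqRel) : Prop :=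
  ∀ i : Fin ν.length, ν.rel i ⟨ν.length - 1, Nat.sub_lt ν.pos one_pos⟩ → (i : ℕ) = ν.length - 1

/-- Some class of `σ` contains none of the largest `b - 1` points of `σ`. -/
def HasInactiveClass (b : ℕ) (σ : EqRel) : Prop :=
  ∃ c ∈ σ.rel.classes, ∀ i ∈ c, (i : ℕ) + (b - 1) < σ.length

/-- A special vertex `ν` is ambiguous if there are an edge `(μ, ν)` and a `σ ∈ Av(B)`, of length at
least `b`, with an inactive class whose associated path ends at `μ`. -/
def IsAmbiguous (B : Finset EqRel) (ν : level B) : Prop :=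
  IsSpecial ν.1 ∧ ∃ μ : level B, (factorGraph B).Adj μ ν ∧
    ∃ σ ∈ Av (B : Set EqRel), ∃ (hb : 0 < maxLength B) (h : maxLength B ≤ σ.length),
      HasInactiveClass (maxLength B) σ ∧
      (windows σ (maxLength B) hb h).getLast? = some μ.1

end ConsEq

/-! Atomicity of a downward closed set is the joint embedding property: any two members lie below a
third. Put `b = maxLength B`. Every member of length at least `b` has a path in the factor graph,
formed by its restrictions to `b` consecutive points. Conversely every nonempty walk is the path of
a member: consecutive windows can be amalgamated, and avoidance of `B` can be checked window by
window (`exists_amalgam`, `IsPath.mem_Av`, `exists_isPath_of_isChain`). The path need not determine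
the member. If a class has left the last `b - 1` points, a new point that is alone in its window may
join that class or not; this is ambiguity, and it is the only source of non-uniqueness
(`IsPath.eq_of_not_isAmbiguous`, `IsAmbiguous.exists_ne`).

If the graph is strongly connected, two members are placed one after the other along a connecting
walk. Otherwise joint embedding of members forces joint embedding of walks (`JointWalks`), hence an
edge `(p, q)` that lies on no closed walk. A walk uses this edge at most once, so any two walks
through it are aligned in a common walk. Therefore the continuation after `q` and the history before
`p` are forced; such an edge is a pivot (`IsPivot`). For finite digraphs a pivot yields a bicycle, a
bicycle that is not strongly connected has a pivot, and a pivot gives back `JointWalks`.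

It remains to pass from walks to members. In an atomic set without strong connectivity, two members
with the same path are extended over `(p, q)` and embedded in a common member; the single occurrence
of `(p, q)` there makes them coincide, so no vertex is ambiguous (`IsPath.eq_of_directedOn`).
Conversely, without ambiguity two members whose paths lie in a common walk both extend along that
walk, to the same member. -/

namespace ConsEq

open Relation List

/-! ### Walks in a digraph, joint walks and pivots -/

section Digraphs

variable {V : Type*} {r : V → V → Prop} {p q : V}

theorem reflTransGen_of_getElem? {W : List V} (hW : W.IsChain r) {i j : ℕ} {a b : V}
    (hij : i ≤ j) (ha : W[i]? = some a) (hb : W[j]? = some b) : ReflTransGen r a b := by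
  obtain ⟨hi, rfl⟩ := List.getElem?_eq_some_iff.1 ha
  obtain ⟨hj, rfl⟩ := List.getElem?_eq_some_iff.1 hb
  rcases hij.eq_or_lt with rfl | hlt
  · exact .refl
  · have h : W.IsChain (ReflTransGen r) := hW.imp fun _ _ h => ReflTransGen.single h
    exact List.pairwise_iff_getElem.1 h.pairwise i j hi hj hlt

theorem exists_shift_of_infix {w W : List V} (h : w <:+: W) :
    ∃ k, ∀ (i : ℕ) (a : V), w[i]? = some a → W[i + k]? = some a := by
  obtain ⟨k, -, hk⟩ := List.infix_iff_getElem?.1 h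
  refine ⟨k, fun i a ha => ?_⟩
  obtain ⟨hi, rfl⟩ := List.getElem?_eq_some_iff.1 ha
  exact hk i hi

theorem exists_chain_concat {a b : V} (h : ReflTransGen r a b) :
    ∃ l, (l ++ [b]).IsChain r ∧ (l ++ [b]).head? = some a := by
  obtain ⟨l, hl, hlast⟩ := List.exists_isChain_cons_of_relationReflTransGen h
  refine ⟨(a :: l).dropLast, ?_, ?_⟩
  · rw [← hlast, List.dropLast_append_getLast]; exact hl
  · rw [← hlast, List.dropLast_append_getLast]; rfl

theorem exists_chain_cons {a b : V} (h : ReflTransGen r a b) :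
    ∃ l, (a :: l).IsChain r ∧ (a :: l).getLast? = some b := by
  obtain ⟨l, hl, hlast⟩ := List.exists_isChain_cons_of_relationReflTransGen h
  exact ⟨l, hl, by rw [← hlast, List.getLast?_eq_some_getLast]⟩

/-- Two occurrences in a walk of an edge that lies on no closed walk coincide. -/
theorem edge_index_unique {W : List V} (hW : W.IsChain r) (hqp : ¬ ReflTransGen r q p) {i j : ℕ}
    (hi : W[i]? = some p) (hi' : W[i + 1]? = some q)
    (hj : W[j]? = some p) (hj' : W[j + 1]? = some q) : i = j := by
  rcases lt_trichotomy i j with h | h | h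
  · exact absurd (reflTransGen_of_getElem? hW (by omega) hi' hj) hqp
  · exact h
  · exact absurd (reflTransGen_of_getElem? hW (by omega) hj' hi) hqp

/-- Any two walks are parts of a common walk. -/
def JointWalks (r : V → V → Prop) : Prop :=
  ∀ w₁ w₂ : List V, w₁ ≠ [] → w₂ ≠ [] → w₁.IsChain r → w₂.IsChain r →
    ∃ W : List V, W.IsChain r ∧ w₁ <:+: W ∧ w₂ <:+: W

/-- The edge `(p, q)` separates the digraph into the vertices that reach `p`, each of them
with at most one edge going in, and the vertices reachable from `q`, each of them with at most one
edge going out, and it is the only edge from the former to the latter. -/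
structure IsPivot (r : V → V → Prop) (p q : V) : Prop where
  adj : r p q
  not_reach : ¬ ReflTransGen r q p
  cover : ∀ v, ReflTransGen r v p ∨ ReflTransGen r q v
  in_unique : ∀ u u' v, ReflTransGen r v p → r u v → r u' v → u = u'
  out_unique : ∀ v u u', ReflTransGen r q v → r v u → r v u' → u = u'
  cross : ∀ u v, r u v → ReflTransGen r u p → ReflTransGen r q v → u = p ∧ v = q

theorem reflTransGen_swap' {a b : V} :
    ReflTransGen (fun x y => r y x) a b ↔ ReflTransGen r b a :=
  Relation.reflTransGen_swap (r := r)

theorem IsPivot.flip (h : IsPivot r p q) : IsPivot (fun x y => r y x) q p where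
  adj := h.adj
  not_reach := by rw [reflTransGen_swap']; exact h.not_reach
  cover v := by simp only [reflTransGen_swap']; exact (h.cover v).symm
  in_unique u u' v hv := h.out_unique v u u' (reflTransGen_swap'.1 hv)
  out_unique v u u' hv := h.in_unique u u' v (reflTransGen_swap'.1 hv)
  cross u v huv hu hv := (h.cross v u huv (reflTransGen_swap'.1 hv) (reflTransGen_swap'.1 hu)).symm

/-- If the ends of every edge were joined by a walk back, reachability would be symmetric. Any two
vertices lie on a common walk, so one reaches the other, and strong connectivity would follow. -/
theorem JointWalks.exists_not_reach (hJ : JointWalks r)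
    (hS : ¬ ∀ u v, ReflTransGen r u v) : ∃ p q, r p q ∧ ¬ ReflTransGen r q p := by
  by_contra! hrev
  apply hS
  intro u v
  obtain ⟨W, hW, h₁, h₂⟩ := hJ [u] [v] (by simp) (by simp) (by simp) (by simp)
  obtain ⟨k, hk⟩ := exists_shift_of_infix h₁
  obtain ⟨l, hl⟩ := exists_shift_of_infix h₂
  have hu := hk 0 u rfl
  have hv := hl 0 v rfl
  rcases le_total (0 + k) (0 + l) with hle | hle
  · exact reflTransGen_of_getElem? hW hle hu hv
  · have hvu := reflTransGen_of_getElem? hW hle hv hu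
    clear hu hv hk h₁
    induction hvu with
    | refl => exact .refl
    | tail _ hbc ih => exact (hrev _ _ hbc).trans ih

/-- In a common walk the two occurrences of `(p, q)` fall on the same place, so the walks agree at
equal offsets from that edge. The condition `m + j = n + i` expresses equal offsets without
subtraction. -/
theorem JointWalks.align (hJ : JointWalks r) (hqp : ¬ ReflTransGen r q p) {w₁ w₂ : List V}
    (h₁ : w₁.IsChain r) (h₂ : w₂.IsChain r) {i j : ℕ}
    (hi : w₁[i]? = some p) (hi' : w₁[i + 1]? = some q)
    (hj : w₂[j]? = some p) (hj' : w₂[j + 1]? = some q) {m n : ℕ} (hmn : m + j = n + i)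
    {a b : V} (ha : w₁[m]? = some a) (hb : w₂[n]? = some b) : a = b := by
  obtain ⟨W, hW, hw₁, hw₂⟩ := hJ w₁ w₂ (by rintro rfl; simp at hi) (by rintro rfl; simp at hj)
    h₁ h₂
  obtain ⟨k, hk⟩ := exists_shift_of_infix hw₁
  obtain ⟨l, hl⟩ := exists_shift_of_infix hw₂
  have e := edge_index_unique hW hqp (hk _ _ hi) (by simpa [add_right_comm] using hk _ _ hi')
    (hl _ _ hj) (by simpa [add_right_comm] using hl _ _ hj')
  have ha' := hk _ _ ha
  have hb' := hl _ _ hb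
  rw [show m + k = n + l by omega, hb'] at ha'
  exact (Option.some.inj ha').symm

/-- Reversal of all edges lets uniqueness of incoming edges follow from uniqueness of outgoing ones.
-/
theorem JointWalks.flip (hJ : JointWalks r) : JointWalks (fun x y => r y x) := by
  intro w₁ w₂ n₁ n₂ h₁ h₂
  obtain ⟨W, hW, i₁, i₂⟩ := hJ w₁.reverse w₂.reverse (by simpa) (by simpa)
    (List.isChain_reverse.2 h₁) (List.isChain_reverse.2 h₂)
  exact ⟨W.reverse, List.isChain_reverse.2 hW, by simpa using List.reverse_infix.2 i₁,
    by simpa using List.reverse_infix.2 i₂⟩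

/-- The walks `p, q, …, v, u` and `p, q, …, v, u'` have equal length and both start with the edge
`(p, q)`, so alignment identifies their ends. -/
theorem JointWalks.out_unique (hJ : JointWalks r) (hpq : r p q) (hqp : ¬ ReflTransGen r q p)
    (v u u' : V) (hv : ReflTransGen r q v) (hu : r v u) (hu' : r v u') : u = u' := by
  obtain ⟨l, hl, hlast⟩ := exists_chain_cons hv
  have key : ∀ x, r v x → (p :: ((q :: l) ++ [x])).IsChain r := fun x hx => by
    rw [List.cons_append, List.isChain_cons_cons]
    refine ⟨hpq, ?_⟩
    rw [← List.cons_append]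
    refine hl.append (by simp) ?_
    rw [hlast]
    simpa using hx
  exact hJ.align hqp (key u hu) (key u' hu') (i := 0) (j := 0) rfl rfl rfl rfl
    (m := l.length + 2) (n := l.length + 2) rfl (by simp) (by simp)

/-- For `cover` and `cross`, the position of the given vertex or edge is compared with that of `(p,
q)` in a common walk. -/
theorem JointWalks.isPivot (hJ : JointWalks r) (hpq : r p q) (hqp : ¬ ReflTransGen r q p) :
    IsPivot r p q where
  adj := hpq
  not_reach := hqp
  cover v := by
    obtain ⟨W, hW, h₁, h₂⟩ := hJ [v] [p, q] (by simp) (by simp) (by simp) (by simpa)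
    obtain ⟨k, hk⟩ := exists_shift_of_infix h₁
    obtain ⟨l, hl⟩ := exists_shift_of_infix h₂
    rcases le_or_gt (0 + k) (0 + l) with hle | hlt
    · exact .inl (reflTransGen_of_getElem? hW hle (hk 0 v rfl) (hl 0 p rfl))
    · exact .inr (reflTransGen_of_getElem? hW (by omega) (hl 1 q rfl) (hk 0 v rfl))
  out_unique := hJ.out_unique hpq hqp
  in_unique u u' v hv := hJ.flip.out_unique (p := q) (q := p) hpq
    (by rwa [reflTransGen_swap']) v u u' (reflTransGen_swap'.2 hv)
  cross u v huv hu hv := by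
    obtain ⟨W, hW, h₁, h₂⟩ := hJ [u, v] [p, q] (by simp) (by simp) (by simpa) (by simpa)
    obtain ⟨k, hk⟩ := exists_shift_of_infix h₁
    obtain ⟨l, hl⟩ := exists_shift_of_infix h₂
    have eu := hk 0 u rfl
    have ev := hk 1 v rfl
    have ep := hl 0 p rfl
    have eq := hl 1 q rfl
    rcases lt_trichotomy k l with h | rfl | h
    · exact absurd (hv.trans (reflTransGen_of_getElem? hW (by omega) ev ep)) hqp
    · rw [eu] at ep
      rw [ev] at eq
      exact ⟨Option.some.inj ep, Option.some.inj eq⟩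
    · exact absurd ((reflTransGen_of_getElem? hW (by omega) eq eu).trans hu) hqp

/-! ### A pivot gives joint walks -/

theorem prefix_or_prefix_of_chain {x : V}
    (huniq : ∀ v u u', ReflTransGen r x v → r v u → r v u' → u = u') {l₁ l₂ : List V}
    (h₁ : (x :: l₁).IsChain r) (h₂ : (x :: l₂).IsChain r) : l₁ <+: l₂ ∨ l₂ <+: l₁ := by
  induction l₁ generalizing x l₂ with
  | nil => exact .inl List.nil_prefix
  | cons y l₁ ih =>
    cases l₂ with
    | nil => exact .inr List.nil_prefix
    | cons z l₂ =>
      rw [List.isChain_cons_cons] at h₁ h₂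
      obtain rfl := huniq x y z .refl h₁.1 h₂.1
      have := ih (fun v u u' hv => huniq v u u' (hv.head h₁.1)) h₁.2 h₂.2
      simpa [List.cons_prefix_cons] using this

/-- The walk starts on the side of `p` and ends on the side of `q`; the only edge by which it can
change sides is `(p, q)`. -/
theorem IsPivot.exists_split (h : IsPivot r p q) {x y : V} {t : List V}
    (hc : (x :: t).IsChain r) (hy : (x :: t).getLast? = some y) (hx : ReflTransGen r x p)
    (hqy : ReflTransGen r q y) : ∃ A B, x :: t = A ++ p :: q :: B := by
  induction t generalizing x with
  | nil =>
    obtain rfl : x = y := by simpa using hy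
    exact absurd (hqy.trans hx) h.not_reach
  | cons z t ih =>
    rw [List.isChain_cons_cons] at hc
    rw [List.getLast?_cons_cons] at hy
    rcases h.cover z with hz | hz
    · obtain ⟨A, B, e⟩ := ih hc.2 hy hz
      exact ⟨x :: A, B, by rw [e]; rfl⟩
    · obtain ⟨rfl, rfl⟩ := h.cross x z hc.1 hx hz
      exact ⟨[], t, rfl⟩

/-- A walk that ends on the side of `p` is continued to `p` and over the edge; one that starts on
the side of `q` is preceded by the edge and a walk from `q`; any other walk already crosses the
edge. -/
theorem IsPivot.exists_extension (h : IsPivot r p q) {w : List V} (hw : w ≠ [])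
    (hc : w.IsChain r) : ∃ A B, (A ++ p :: q :: B).IsChain r ∧ w <:+: A ++ p :: q :: B := by
  obtain ⟨x, t, rfl⟩ := List.exists_cons_of_ne_nil hw
  obtain ⟨y, hy⟩ : ∃ y, (x :: t).getLast? = some y := ⟨_, List.getLast?_eq_some_getLast hw⟩
  rcases h.cover y with hyp | hqy
  · obtain ⟨l, hl, hlast⟩ := exists_chain_concat hyp
    obtain ⟨s, hs⟩ : ∃ s, x :: t = s ++ [y] := ⟨(x :: t).dropLast, by
      rw [List.getLast?_eq_some_getLast hw] at hy
      rw [← Option.some.inj hy, List.dropLast_append_getLast]⟩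
    have hA : ∃ A, A ++ [p] = s ++ (l ++ [p]) := ⟨s ++ l, by simp⟩
    obtain ⟨A, hA⟩ := hA
    have hsl : (s ++ (l ++ [p])).IsChain r := by
      obtain ⟨m, hm⟩ : ∃ m, l ++ [p] = y :: m := by
        cases l with
        | nil => exact ⟨[], by simpa using hlast⟩
        | cons a l => exact ⟨l ++ [p], by simpa using hlast⟩
      rw [hm] at hl ⊢
      exact List.isChain_split.2 ⟨hs ▸ hc, hl⟩
    refine ⟨A, [], ?_, ?_⟩
    · rw [List.isChain_split, hA]
      exact ⟨hsl, by simpa using h.adj⟩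
    · have : A ++ [p, q] = s ++ (l ++ [p]) ++ [q] := by rw [← hA]; simp
      rw [this, hs]
      cases l with
      | nil =>
        obtain rfl : p = y := by simpa using hlast
        exact ⟨[], [q], by simp⟩
      | cons a l =>
        obtain rfl : a = y := by simpa using hlast
        exact ⟨[], l ++ [p, q], by simp⟩
  · rcases h.cover x with hxp | hqx
    · obtain ⟨A, B, e⟩ := h.exists_split hc hy hxp hqy
      exact ⟨A, B, e ▸ hc, e ▸ List.infix_rfl⟩
    · obtain ⟨l, hl, hlast⟩ := exists_chain_cons hqx
      obtain ⟨s, hs⟩ : ∃ s, q :: l = s ++ [x] := ⟨(q :: l).dropLast, by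
        rw [List.getLast?_eq_some_getLast (by simp)] at hlast
        rw [← Option.some.inj hlast, List.dropLast_append_getLast]⟩
      refine ⟨[], l ++ t, ?_, ?_⟩
      · have : (s ++ x :: t).IsChain r := List.isChain_split.2 ⟨hs ▸ hl, hc⟩
        have e : q :: (l ++ t) = s ++ x :: t := by
          rw [← List.cons_append, hs]; simp
        simp only [List.nil_append, List.isChain_cons_cons]
        exact ⟨h.adj, e ▸ this⟩
      · refine ⟨p :: s, [], ?_⟩
        have e : q :: (l ++ t) = s ++ x :: t := by
          rw [← List.cons_append, hs]; simp
        simp [e]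

/-- Once both walks are extended over `(p, q)`, they can differ only in how far they run forwards
from `q` and backwards from `p`. The longer part is taken on each side. -/
theorem IsPivot.jointWalks (h : IsPivot r p q) : JointWalks r := by
  intro w₁ w₂ n₁ n₂ h₁ h₂
  obtain ⟨A₁, B₁, c₁, i₁⟩ := h.exists_extension n₁ h₁
  obtain ⟨A₂, B₂, c₂, i₂⟩ := h.exists_extension n₂ h₂
  rw [List.isChain_append_cons_cons] at c₁ c₂
  have hB : ∃ B, (q :: B).IsChain r ∧ B₁ <+: B ∧ B₂ <+: B := by
    rcases prefix_or_prefix_of_chain h.out_unique c₁.2.2 c₂.2.2 with hp | hp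
    · exact ⟨B₂, c₂.2.2, hp, List.prefix_rfl⟩
    · exact ⟨B₁, c₁.2.2, List.prefix_rfl, hp⟩
  have hA : ∃ A, (A ++ [p]).IsChain r ∧ A₁ <:+ A ∧ A₂ <:+ A := by
    have d₁ : (p :: A₁.reverse).IsChain (fun x y => r y x) := by
      simpa using List.isChain_reverse.2 c₁.1
    have d₂ : (p :: A₂.reverse).IsChain (fun x y => r y x) := by
      simpa using List.isChain_reverse.2 c₂.1
    rcases prefix_or_prefix_of_chain h.flip.out_unique d₁ d₂ with hp | hp
    · exact ⟨A₂, c₂.1, List.reverse_prefix.1 hp, List.suffix_rfl⟩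
    · exact ⟨A₁, c₁.1, List.suffix_rfl, List.reverse_prefix.1 hp⟩
  obtain ⟨A, cA, hA₁, hA₂⟩ := hA
  obtain ⟨B, cB, hB₁, hB₂⟩ := hB
  have key : ∀ A' B', A' <:+ A → B' <+: B → A' ++ p :: q :: B' <:+: A ++ p :: q :: B := by
    rintro A' B' ⟨s, rfl⟩ ⟨t, rfl⟩
    exact ⟨s, t, by simp⟩
  exact ⟨A ++ p :: q :: B, List.isChain_append_cons_cons.2 ⟨cA, h.adj, cB⟩,
    i₁.trans (key _ _ hA₁ hB₁), i₂.trans (key _ _ hA₂ hB₂)⟩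

end Digraphs

/-! ### Bicycles and pivots -/

section Bicycles

variable {V : Type*} {r : V → V → Prop} {p q : V}

theorem pathEdge_iff_getElem? {l : List V} {u v : V} :
    PathEdge l u v ↔ ∃ k, l[k]? = some u ∧ l[k + 1]? = some v := by
  constructor
  · intro h
    obtain ⟨k, hk⟩ := exists_shift_of_infix h
    exact ⟨k, by simpa using hk 0 u rfl, by simpa [add_comm] using hk 1 v rfl⟩
  · rintro ⟨k, hu, hv⟩
    obtain ⟨hi, rfl⟩ := List.getElem?_eq_some_iff.1 hu
    obtain ⟨hj, rfl⟩ := List.getElem?_eq_some_iff.1 hv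
    refine ⟨l.take k, l.drop (k + 2), ?_⟩
    rw [List.append_assoc]
    conv_rhs => rw [← List.take_append_drop k l]
    rw [List.drop_eq_getElem_cons hi, List.drop_eq_getElem_cons hj]
    rfl

theorem PathEdge.mem_left {l : List V} {u v : V} (h : PathEdge l u v) : u ∈ l :=
  h.subset (by simp)

theorem PathEdge.mem_right {l : List V} {u v : V} (h : PathEdge l u v) : v ∈ l :=
  h.subset (by simp)

theorem pathEdge_cons_cons {a b u v : V} {l : List V} :
    PathEdge (a :: b :: l) u v ↔ (u = a ∧ v = b) ∨ PathEdge (b :: l) u v := by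
  rw [PathEdge, List.infix_cons_iff]
  simp [List.cons_prefix_cons, PathEdge]

theorem not_pathEdge_nil {u v : V} : ¬ PathEdge [] u v := fun h => by simpa using h.mem_left

theorem not_pathEdge_singleton {a u v : V} : ¬ PathEdge [a] u v := fun h => by
  simpa using h.length_le

theorem pathEdge_append_cons {l₁ l₂ : List V} {a u v : V} :
    PathEdge (l₁ ++ a :: l₂) u v ↔ PathEdge (l₁ ++ [a]) u v ∨ PathEdge (a :: l₂) u v := by
  induction l₁ with
  | nil => simp [not_pathEdge_singleton]
  | cons b l₁ ih =>
    cases l₁ with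
    | nil => simp [pathEdge_cons_cons, not_pathEdge_singleton]
    | cons c l₁ =>
      simp only [List.cons_append] at ih
      simp only [List.cons_append, pathEdge_cons_cons, ih, or_assoc]

theorem pathEdge_append_append {l₁ l₂ : List V} {a b u v : V} :
    PathEdge (l₁ ++ a :: b :: l₂) u v ↔
      PathEdge (l₁ ++ [a]) u v ∨ (u = a ∧ v = b) ∨ PathEdge (b :: l₂) u v := by
  rw [pathEdge_append_cons, pathEdge_cons_cons]

theorem pathEdge_reverse {l : List V} {u v : V} : PathEdge l.reverse u v ↔ PathEdge l v u := by
  rw [PathEdge, PathEdge, ← List.reverse_infix]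
  simp

theorem isChain_pathEdge (l : List V) : l.IsChain (PathEdge l) := List.isChain_isInfix l

theorem PathEdge.rel {l : List V} (hl : l.IsChain r) {u v : V} (h : PathEdge l u v) : r u v := by
  simpa using hl.infix h

/-- The last vertex is exempt from `Nodup` so that the lemma covers closed paths, which repeat their
first vertex at the end. -/
theorem PathEdge.right_unique {l : List V} (hl : l.dropLast.Nodup) {u v v' : V}
    (h : PathEdge l u v) (h' : PathEdge l u v') : v = v' := by
  obtain ⟨i, hi, hi'⟩ := pathEdge_iff_getElem?.1 h
  obtain ⟨j, hj, hj'⟩ := pathEdge_iff_getElem?.1 h'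
  obtain ⟨li, -⟩ := List.getElem?_eq_some_iff.1 hi'
  obtain ⟨lj, -⟩ := List.getElem?_eq_some_iff.1 hj'
  have hij : i = j := by
    refine (List.Nodup.getElem_inj_iff hl (hi := by simp; omega) (hj := by simp; omega)).1 ?_
    rw [List.getElem_dropLast, List.getElem_dropLast]
    obtain ⟨_, e⟩ := List.getElem?_eq_some_iff.1 hi
    obtain ⟨_, e'⟩ := List.getElem?_eq_some_iff.1 hj
    rw [e, e']
  subst hij
  rw [hi'] at hj'
  exact Option.some.inj hj'

theorem PathEdge.left_unique {l : List V} (hl : l.tail.Nodup) {u u' v : V}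
    (h : PathEdge l u v) (h' : PathEdge l u' v) : u = u' := by
  rw [← pathEdge_reverse] at h h'
  refine h.right_unique ?_ h'
  rw [List.dropLast_reverse]
  exact List.nodup_reverse.2 hl

theorem cycleEdge_cons {x u v : V} {l : List V} :
    CycleEdge (x :: l) u v ↔ PathEdge (x :: (l ++ [x])) u v := by
  simp [CycleEdge]

theorem not_cycleEdge_nil {u v : V} : ¬ CycleEdge [] u v := not_pathEdge_nil

theorem CycleEdge.mem {c : List V} {u v : V} (h : CycleEdge c u v) : u ∈ c ∧ v ∈ c := by
  cases c with
  | nil => exact absurd h not_cycleEdge_nil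
  | cons x l =>
    rw [cycleEdge_cons] at h
    have h₁ := h.mem_left
    have h₂ := h.mem_right
    simp only [List.mem_cons, List.mem_append, List.not_mem_nil, or_false] at h₁ h₂ ⊢
    tauto

theorem CycleEdge.right_unique {c : List V} (hc : c.Nodup) {u v v' : V}
    (h : CycleEdge c u v) (h' : CycleEdge c u v') : v = v' := by
  cases c with
  | nil => exact absurd h not_cycleEdge_nil
  | cons x l =>
    rw [cycleEdge_cons] at h h'
    refine h.right_unique ?_ h'
    rw [← List.cons_append, List.dropLast_concat]
    exact hc

theorem CycleEdge.left_unique {c : List V} (hc : c.Nodup) {u u' v : V}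
    (h : CycleEdge c u v) (h' : CycleEdge c u' v) : u = u' := by
  cases c with
  | nil => exact absurd h not_cycleEdge_nil
  | cons x l =>
    rw [cycleEdge_cons] at h h'
    refine h.left_unique ?_ h'
    rw [List.tail_cons]
    exact (List.perm_append_singleton x l).nodup_iff.2 hc

theorem reflTransGen_cycle {c : List V} (hr : ∀ u v, CycleEdge c u v → r u v) {u v : V}
    (hu : u ∈ c) (hv : v ∈ c) : ReflTransGen r u v := by
  cases c with
  | nil => simp at hu
  | cons x l =>
    have hc : (x :: (l ++ [x])).IsChain r :=
      (isChain_pathEdge _).imp fun a b h => hr a b (cycleEdge_cons.2 h)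
    obtain ⟨i, hi, rfl⟩ := List.mem_iff_getElem.1 hu
    obtain ⟨j, hj, rfl⟩ := List.mem_iff_getElem.1 hv
    have e : ∀ k (hk : k < (x :: l).length), (x :: (l ++ [x]))[k]? = some (x :: l)[k] := by
      intro k hk
      rw [← List.cons_append, List.getElem?_append_left hk, List.getElem?_eq_getElem hk]
    refine (reflTransGen_of_getElem? hc (j := l.length + 1) (b := x) (by simp at hi; omega)
      (e i hi) (by simp)).trans
      (reflTransGen_of_getElem? hc (Nat.zero_le _) (a := x) rfl (e j hj))

/-- The reversal of a closed path. -/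
def reverseCycle : List V → List V
  | [] => []
  | x :: l => x :: l.reverse

theorem mem_reverseCycle {c : List V} {v : V} : v ∈ reverseCycle c ↔ v ∈ c := by
  cases c <;> simp [reverseCycle]

theorem nodup_reverseCycle {c : List V} (hc : c.Nodup) : (reverseCycle c).Nodup := by
  cases c with
  | nil => exact hc
  | cons x l => simpa [reverseCycle] using hc

theorem reverseCycle_eq_nil {c : List V} : reverseCycle c = [] ↔ c = [] := by
  cases c <;> simp [reverseCycle]

theorem cycleEdge_reverseCycle {c : List V} {u v : V} :
    CycleEdge (reverseCycle c) u v ↔ CycleEdge c v u := by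
  cases c with
  | nil => simp [reverseCycle, not_cycleEdge_nil]
  | cons x l =>
    rw [reverseCycle, cycleEdge_cons, cycleEdge_cons, ← pathEdge_reverse]
    simp

/-! ### The part of the digraph that is reachable from a vertex -/

theorem exists_maximal_simple_walk [Finite V] (q : V) :
    ∃ t : List V, (q :: t).Nodup ∧ (q :: t).IsChain r ∧
      ∀ t' : List V, (q :: t').Nodup → (q :: t').IsChain r → t'.length ≤ t.length := by
  have := Fintype.ofFinite V
  let P : ℕ → Prop := fun n => ∃ t : List V, (q :: t).Nodup ∧ (q :: t).IsChain r ∧ t.length = n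
  classical
  have h0 : P 0 := ⟨[], by simp, by simp, rfl⟩
  obtain ⟨t, hn, hc, ht⟩ := Nat.findGreatest_spec (P := P) (Nat.zero_le (Fintype.card V)) h0
  refine ⟨t, hn, hc, fun t' hn' hc' => ?_⟩
  rw [ht]
  refine Nat.le_findGreatest ?_ ⟨t', hn', hc', rfl⟩
  have := hn'.length_le_card
  simp at this
  omega

/-- If every vertex reachable from `q` has at most one edge going out, then the vertices reachable
from `q` form a path that possibly runs into a cycle. -/
theorem exists_path_into_cycle [Finite V]
    (huniq : ∀ v u u', ReflTransGen r q v → r v u → r v u' → u = u') :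
    ∃ s d : List V, (q :: s).Nodup ∧ d.Nodup ∧
      (∀ v ∈ q :: s, v ∈ d ↔ d ≠ [] ∧ (q :: s).getLast? = some v) ∧
      (∀ v, v ∈ q :: s ∨ v ∈ d ↔ ReflTransGen r q v) ∧
      (∀ u v, ReflTransGen r q u → (r u v ↔ PathEdge (q :: s) u v ∨ CycleEdge d u v)) := by
  obtain ⟨t, hn, hc, hmax⟩ := exists_maximal_simple_walk (r := r) q
  have hreach : ∀ v ∈ q :: t, ReflTransGen r q v := fun v hv => by
    obtain ⟨i, hi, rfl⟩ := List.mem_iff_getElem.1 hv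
    exact reflTransGen_of_getElem? hc (Nat.zero_le i) rfl (List.getElem?_eq_getElem hi)
  obtain ⟨a, l, hl⟩ : ∃ a l, q :: t = l ++ [a] :=
    ⟨_, _, (List.dropLast_append_getLast (List.cons_ne_nil q t)).symm⟩
  have hnext : ∀ u ∈ q :: t, u ≠ a → ∃ v, PathEdge (q :: t) u v := fun u hu hua => by
    rw [hl, List.mem_append, List.mem_singleton, or_iff_left hua] at hu
    obtain ⟨i, hi, rfl⟩ := List.mem_iff_getElem.1 hu
    obtain ⟨v, hv⟩ : ∃ v, (l ++ [a])[i + 1]? = some v :=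
      ⟨_, List.getElem?_eq_getElem (by rw [List.length_append, List.length_singleton]; omega)⟩
    rw [hl]
    exact ⟨v, pathEdge_iff_getElem?.2
      ⟨i, by rw [List.getElem?_append_left hi, List.getElem?_eq_getElem hi], hv⟩⟩
  have hout : ∀ u ∈ q :: t, ∀ v, r u v → PathEdge (q :: t) u v ∨ u = a := fun u hu v huv => by
    by_cases hua : u = a
    · exact .inr hua
    · obtain ⟨w, hw⟩ := hnext u hu hua
      obtain rfl := huniq u v w (hreach u hu) huv (hw.rel hc)
      exact .inl hw
  have hamem : a ∈ q :: t := by rw [hl]; simp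
  -- By maximality of the simple walk, an edge out of its last vertex `a` returns to the walk.
  have hclosed : ∀ u, r a u → u ∈ q :: t := fun u hau => by
    by_contra hu
    have := hmax (t ++ [u])
      (by
        rw [← List.cons_append]
        exact (List.perm_append_singleton u _).nodup_iff.2 (List.nodup_cons.2 ⟨hu, hn⟩))
      (by
        rw [← List.cons_append]
        refine hc.append (by simp) ?_
        rw [hl]
        simpa using hau)
    simp at this
  have hall : ∀ v, v ∈ q :: t ↔ ReflTransGen r q v := fun v => by
    refine ⟨hreach v, fun h => ?_⟩
    induction h with
    | refl => simp
    | tail _ hbc ih =>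
      rcases hout _ ih _ hbc with h | rfl
      · exact h.mem_right
      · exact hclosed _ hbc
  -- If `a` has an edge to `v`, the segment from `v` to `a` is the cycle `d`, and the path stops at
  -- `v`, the only vertex shared with the cycle. Otherwise the whole walk is the path and the cycle
  -- is empty.
  by_cases ha : ∃ v, r a v
  · obtain ⟨v, hav⟩ := ha
    obtain ⟨s₁, s₂, hs⟩ := List.append_of_mem (hclosed v hav)
    obtain ⟨s, hqs⟩ : ∃ s, q :: s = s₁ ++ [v] := by
      cases s₁ with
      | nil => exact ⟨[], by simp at hs; simp [hs.1]⟩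
      | cons b s₁ => exact ⟨s₁ ++ [v], by simp at hs; simp [hs.1]⟩
    have hdrop : ∃ m, v :: s₂ = m ++ [a] := by
      refine ⟨(v :: s₂).dropLast, ?_⟩
      have : (q :: t).getLast? = some a := by rw [hl]; simp
      rw [hs, List.getLast?_append, List.getLast?_eq_some_getLast (List.cons_ne_nil v s₂)] at this
      rw [← (by simpa using this : (v :: s₂).getLast (List.cons_ne_nil v s₂) = a),
        List.dropLast_append_getLast]
    obtain ⟨m, hm⟩ := hdrop
    have hcyc : ∀ x y, CycleEdge (v :: s₂) x y ↔ PathEdge (v :: s₂) x y ∨ (x = a ∧ y = v) := by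
      intro x y
      rw [cycleEdge_cons, ← List.cons_append, hm, List.append_assoc, List.singleton_append,
        pathEdge_append_cons, pathEdge_cons_cons]
      simp [not_pathEdge_singleton]
    rw [hs] at hn
    have hn' := List.nodup_append.1 hn
    refine ⟨s, v :: s₂, ?_, hn'.2.1, ?_, ?_, ?_⟩
    · rw [hqs]
      rw [List.append_cons] at hn
      exact hn.sublist (List.sublist_append_left _ _)
    · intro w hw
      rw [hqs] at hw ⊢
      simp only [ne_eq, reduceCtorEq, not_false_eq_true, true_and, List.getLast?_append,
        List.getLast?_singleton, Option.some_or, Option.some.injEq]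
      constructor
      · intro hwd
        rcases List.mem_append.1 hw with h | h
        · exact absurd rfl (hn'.2.2 w h w hwd)
        · exact (List.mem_singleton.1 h).symm
      · rintro rfl
        simp
    · intro w
      rw [← hall, hqs, hs]
      simp only [List.mem_append, List.mem_cons, List.not_mem_nil, or_false]
      tauto
    · intro x y hx
      rw [hqs, hcyc, ← or_assoc, ← pathEdge_append_cons, ← hs]
      constructor
      · intro hxy
        rcases hout x ((hall x).2 hx) y hxy with h | rfl
        · exact .inl h
        · exact .inr ⟨rfl, huniq _ _ _ hx hxy hav⟩
      · rintro (h | ⟨rfl, rfl⟩)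
        · exact h.rel hc
        · exact hav
  · refine ⟨t, [], hn, List.nodup_nil, by simp, by simpa using hall, fun u v hu => ?_⟩
    simp only [not_cycleEdge_nil, or_false]
    refine ⟨fun huv => ?_, fun h => h.rel hc⟩
    rcases hout u ((hall u).2 hu) v huv with h | rfl
    · exact h
    · exact absurd ⟨v, huv⟩ ha

/-- The vertices reachable from `q` form the terminal half; the same argument in the reversed
digraph, from `p`, gives the initial half. The halves are disjoint, as `q` does not reach `p`, and
are joined by `(p, q)` alone. -/
theorem IsPivot.isBicycle [Finite V] {G : Digraph V} (h : IsPivot G.Adj p q) : IsBicycle G := by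
  obtain ⟨s, d, hs, hd, hsd, hR, hRe⟩ := exists_path_into_cycle h.out_unique
  obtain ⟨s', c, hs', hc, hsc, hL, hLe⟩ := exists_path_into_cycle h.flip.out_unique
  simp only [reflTransGen_swap'] at hL hLe
  have hLR : ∀ v, ReflTransGen G.Adj v p → ReflTransGen G.Adj q v → False :=
    fun v h₁ h₂ => h.not_reach (h₂.trans h₁)
  refine ⟨reverseCycle c, (p :: s').reverse ++ q :: s, d, nodup_reverseCycle hc, ?_, hd, ?_, ?_,
    ?_, ?_, ?_, ?_⟩
  · refine List.nodup_append.2 ⟨List.nodup_reverse.2 hs', hs, ?_⟩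
    rintro a ha _ hb rfl
    exact hLR a ((hL a).1 (.inl (List.mem_reverse.1 ha))) ((hR a).1 (.inl hb))
  · intro v hv hv'
    exact hLR v ((hL v).1 (.inr (mem_reverseCycle.1 hv))) ((hR v).1 (.inr hv'))
  · intro v hv
    rw [mem_reverseCycle, ne_eq, reverseCycle_eq_nil]
    have hhead : ((p :: s').reverse ++ q :: s).head? = (p :: s').getLast? := by
      rw [List.head?_append, List.head?_reverse, List.getLast?_eq_some_getLast (by simp)]
      rfl
    rw [hhead]
    rcases List.mem_append.1 hv with h' | h'
    · exact hsc v (List.mem_reverse.1 h')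
    · have hRv := (hR v).1 (.inl h')
      refine iff_of_false (fun hvc => hLR v ((hL v).1 (.inr hvc)) hRv) fun hvl => ?_
      exact hLR v ((hL v).1 (.inl (List.mem_of_getLast? hvl.2))) hRv
  · intro v hv
    have hlast : ((p :: s').reverse ++ q :: s).getLast? = (q :: s).getLast? := by
      rw [List.getLast?_append, List.getLast?_eq_some_getLast (List.cons_ne_nil q s)]
      rfl
    rw [hlast]
    rcases List.mem_append.1 hv with h' | h'
    · have hLv := (hL v).1 (.inl (List.mem_reverse.1 h'))
      refine iff_of_false (fun hvd => hLR v hLv ((hR v).1 (.inr hvd))) fun hvl => ?_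
      exact hLR v hLv ((hR v).1 (.inl (List.mem_of_getLast? hvl.2)))
    · exact hsd v h'
  · intro _ _
    simp
    omega
  · intro v
    rw [mem_reverseCycle]
    rcases h.cover v with hv | hv
    · rcases (hL v).2 hv with h' | h'
      · exact .inr (.inl (List.mem_append_left _ (List.mem_reverse.2 h')))
      · exact .inl h'
    · rcases (hR v).2 hv with h' | h'
      · exact .inr (.inl (List.mem_append_right _ h'))
      · exact .inr (.inr h')
  · intro u v
    have hpath : PathEdge ((p :: s').reverse ++ q :: s) u v ↔
        PathEdge (p :: s') v u ∨ (u = p ∧ v = q) ∨ PathEdge (q :: s) u v := by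
      rw [List.reverse_cons, List.append_assoc, List.singleton_append, pathEdge_append_append,
        ← List.reverse_cons, pathEdge_reverse]
    rw [hpath, cycleEdge_reverseCycle]
    constructor
    · intro huv
      rcases h.cover u with hu | hu
      · rcases h.cover v with hv | hv
        · rcases (hLe v u hv).1 huv with h' | h'
          · exact .inr (.inl (.inl h'))
          · exact .inl h'
        · exact .inr (.inl (.inr (.inl (h.cross u v huv hu hv))))
      · rcases (hRe u v hu).1 huv with h' | h'
        · exact .inr (.inl (.inr (.inr h')))
        · exact .inr (.inr h')
    · rintro (h' | (h' | ⟨rfl, rfl⟩ | h') | h')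
      · exact (hLe v u ((hL v).1 (.inr h'.mem.1))).2 (.inr h')
      · exact (hLe v u ((hL v).1 (.inl h'.mem_left))).2 (.inl h')
      · exact h.adj
      · exact (hRe u v ((hR u).1 (.inl h'.mem_left))).2 (.inl h')
      · exact (hRe u v ((hR u).1 (.inr h'.mem.1))).2 (.inr h')

/-- The first edge `(x, y)` of the connecting path is a pivot. If the path has fewer than two
vertices, at most one cycle is nonempty and the digraph is strongly connected. -/
theorem IsBicycle.exists_isPivot {G : Digraph V} (hG : IsBicycle G)
    (hS : ¬ StronglyConnected G) : ∃ p q, IsPivot G.Adj p q := by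
  obtain ⟨c, l, d, hc, hl, hd, hcd, hlc, hld, hlen, hV, hE⟩ := hG
  have hEc : ∀ u v, CycleEdge c u v → G.Adj u v := fun u v h => (hE u v).2 (.inl h)
  have hEd : ∀ u v, CycleEdge d u v → G.Adj u v := fun u v h => (hE u v).2 (.inr (.inr h))
  have hEl : ∀ u v, PathEdge l u v → G.Adj u v := fun u v h => (hE u v).2 (.inr (.inl h))
  rcases l with _ | ⟨x, _ | ⟨y, t⟩⟩
  · exfalso
    apply hS
    intro u v
    have hu := hV u
    have hv := hV v
    simp only [List.not_mem_nil, false_or] at hu hv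
    by_cases c0 : c = []
    · subst c0
      exact reflTransGen_cycle hEd (by simpa using hu) (by simpa using hv)
    · have d0 : d = [] := by
        by_contra d0
        simpa using hlen c0 d0
      subst d0
      exact reflTransGen_cycle hEc (by simpa using hu) (by simpa using hv)
  · exfalso
    apply hS
    intro u v
    have hu := hV u
    have hv := hV v
    have hxc := hlc x (by simp)
    have hxd := hld x (by simp)
    simp only [List.mem_singleton] at hu hv
    simp only [List.head?_cons, and_true, List.getLast?_singleton] at hxc hxd
    by_cases c0 : c = []
    · subst c0
      by_cases d0 : d = []
      · subst d0
        obtain rfl : u = x := by simpa using hu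
        obtain rfl : v = u := by simpa using hv
        exact .refl
      · have hx := hxd.2 d0
        refine reflTransGen_cycle hEd ?_ ?_
        · rcases hu with h | rfl | h <;> simp_all
        · rcases hv with h | rfl | h <;> simp_all
    · have d0 : d = [] := by
        by_contra d0
        simpa using hlen c0 d0
      subst d0
      have hx := hxc.2 c0
      refine reflTransGen_cycle hEc ?_ ?_
      · rcases hu with h | rfl | h <;> simp_all
      · rcases hv with h | rfl | h <;> simp_all
  · have hxyt := List.nodup_cons.1 hl
    have hyc : ∀ v ∈ y :: t, v ∉ c := fun v hv hvc => by
      have := ((hlc v (List.mem_cons_of_mem _ hv)).1 hvc).2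
      simp only [List.head?_cons, Option.some.injEq] at this
      exact hxyt.1 (this ▸ hv)
    have hxd : x ∉ d := fun h => by
      have := ((hld x (by simp)).1 h).2
      rw [List.getLast?_cons_cons] at this
      exact hxyt.1 (List.mem_of_getLast? this)
    have hchain : (x :: y :: t).IsChain G.Adj := (isChain_pathEdge _).imp hEl
    have hLx : ∀ v, ReflTransGen G.Adj v x ↔ v ∈ c ∨ v = x := by
      intro v
      constructor
      · intro h
        induction h using ReflTransGen.head_induction_on with
        | refl => exact .inr rfl
        | head hab _ ih =>
          rcases (hE _ _).1 hab with h | h | h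
          · exact .inl h.mem.1
          · rcases pathEdge_cons_cons.1 h with ⟨rfl, rfl⟩ | h
            · exact .inr rfl
            · exfalso
              have hm := h.mem_right
              rcases ih with ih | rfl
              · exact hyc _ hm ih
              · exact hxyt.1 hm
          · rcases ih with ih | rfl
            · exact absurd h.mem.2 (hcd ih)
            · exact absurd h.mem.2 hxd
      · rintro (h | rfl)
        · exact reflTransGen_cycle hEc h ((hlc x (by simp)).2 ⟨List.ne_nil_of_mem h, rfl⟩)
        · exact .refl
    have hRy : ∀ v, ReflTransGen G.Adj y v ↔ v ∈ y :: t ∨ v ∈ d := by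
      have hyt : ∀ v ∈ y :: t, ReflTransGen G.Adj y v := fun v hv => by
        obtain ⟨i, hi, rfl⟩ := List.mem_iff_getElem.1 hv
        exact reflTransGen_of_getElem? hchain.tail (Nat.zero_le i) rfl
          (List.getElem?_eq_getElem hi)
      intro v
      constructor
      · intro h
        induction h with
        | refl => simp
        | tail _ hab ih =>
          rcases (hE _ _).1 hab with h | h | h
          · rcases ih with ih | ih
            · exact absurd h.mem.1 (hyc _ ih)
            · exact absurd ih (hcd h.mem.1)
          · rcases pathEdge_cons_cons.1 h with ⟨rfl, rfl⟩ | h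
            · simp
            · exact .inl h.mem_right
          · exact .inr h.mem.2
      · rintro (h | h)
        · exact hyt v h
        · obtain ⟨z, hz⟩ : ∃ z, (y :: t).getLast? = some z :=
            ⟨_, List.getLast?_eq_some_getLast (by simp)⟩
          have hzm := List.mem_of_getLast? hz
          have hzd : z ∈ d := (hld z (List.mem_cons_of_mem _ hzm)).2
            ⟨List.ne_nil_of_mem h, by rw [List.getLast?_cons_cons, hz]⟩
          exact (hyt z hzm).trans (reflTransGen_cycle hEd hzd h)
    have hin : ∀ u v, (v ∈ c ∨ v = x) → G.Adj u v → CycleEdge c u v := by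
      intro u v hv huv
      rcases (hE u v).1 huv with h | h | h
      · exact h
      · exfalso
        have hm : v ∈ y :: t := by
          rcases pathEdge_cons_cons.1 h with ⟨rfl, rfl⟩ | h
          · simp
          · exact h.mem_right
        rcases hv with hv | rfl
        · exact hyc _ hm hv
        · exact hxyt.1 hm
      · rcases hv with hv | rfl
        · exact absurd h.mem.2 (hcd hv)
        · exact absurd h.mem.2 hxd
    -- Only the last vertex of the path can lie in `d`, and in a list without repetitions the last
    -- vertex has no successor.
    have hnoout : ∀ v ∈ d, ∀ u, ¬ PathEdge (x :: y :: t) v u := by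
      intro v hv u h
      have hz := ((hld v h.mem_left).1 hv).2
      obtain ⟨k, hk, hk'⟩ := pathEdge_iff_getElem?.1 h
      rw [List.getLast?_eq_getElem?] at hz
      obtain ⟨hk₁, hk₂⟩ := List.getElem?_eq_some_iff.1 hk
      obtain ⟨hk₃, -⟩ := List.getElem?_eq_some_iff.1 hk'
      obtain ⟨hz₁, hz₂⟩ := List.getElem?_eq_some_iff.1 hz
      have := (hl.getElem_inj_iff (hi := hk₁) (hj := hz₁)).1 (hk₂.trans hz₂.symm)
      omega
    have hRout : ∀ v u, (v ∈ y :: t ∨ v ∈ d) → G.Adj v u →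
        PathEdge (x :: y :: t) v u ∨ CycleEdge d v u := by
      intro v u hv hvu
      rcases (hE v u).1 hvu with h | h
      · rcases hv with hv | hv
        · exact absurd h.mem.1 (hyc _ hv)
        · exact absurd hv (hcd h.mem.1)
      · exact h
    refine ⟨x, y, hEl _ _ (pathEdge_cons_cons.2 (.inl ⟨rfl, rfl⟩)), ?_, ?_, ?_, ?_, ?_⟩
    · rw [hRy]
      exact fun h => h.elim hxyt.1 hxd
    · intro v
      rw [hLx, hRy]
      have := hV v
      simp only [List.mem_cons] at this ⊢
      tauto
    · intro u u' v hv hu hu'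
      rw [hLx] at hv
      exact (hin u v hv hu).left_unique hc (hin u' v hv hu')
    · intro v u u' hv hu hu'
      rw [hRy] at hv
      rcases hRout v u hv hu with h | h <;> rcases hRout v u' hv hu' with h' | h'
      · exact h.right_unique (hl.sublist (List.dropLast_sublist _)) h'
      · exact absurd h (hnoout v h'.mem.1 u)
      · exact absurd h' (hnoout v h.mem.1 u')
      · exact h.right_unique hd h'
    · intro u v huv hu hv
      rw [hLx] at hu
      rw [hRy] at hv
      rcases (hE u v).1 huv with h | h | h
      · rcases hv with hv | hv
        · exact absurd h.mem.2 (hyc _ hv)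
        · exact absurd hv (hcd h.mem.2)
      · rcases pathEdge_cons_cons.1 h with h' | h'
        · exact h'
        · have hm := h'.mem_left
          exfalso
          rcases hu with hu | rfl
          · exact hyc _ hm hu
          · exact hxyt.1 hm
      · rcases hu with hu | rfl
        · exact absurd h.mem.1 (hcd hu)
        · exact absurd h.mem.1 hxd

theorem isBicycle_of_jointWalks [Finite V] {G : Digraph V} (hJ : JointWalks G.Adj)
    (hS : ¬ StronglyConnected G) : IsBicycle G := by
  obtain ⟨p, q, hpq, hqp⟩ := hJ.exists_not_reach hS
  exact (hJ.isPivot hpq hqp).isBicycle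

end Bicycles

/-! ### Occurrences and amalgamation of equivalence relations -/

section EquivalenceRelations

variable {ρ σ τ θ : EqRel} {k l : ℕ}

/-- The relation of `ρ` on the points `0, …, ρ.length - 1`, as a relation on `ℕ`. -/
def EqRel.Related (ρ : EqRel) (i j : ℕ) : Prop :=
  ∃ (hi : i < ρ.length) (hj : j < ρ.length), ρ.rel ⟨i, hi⟩ ⟨j, hj⟩

theorem EqRel.Related.lt_left {i j : ℕ} (h : ρ.Related i j) : i < ρ.length := h.1

theorem EqRel.Related.lt_right {i j : ℕ} (h : ρ.Related i j) : j < ρ.length := h.2.1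

theorem EqRel.related_refl {i : ℕ} (hi : i < ρ.length) : ρ.Related i i :=
  ⟨hi, hi, ρ.rel.refl _⟩

theorem EqRel.Related.symm {i j : ℕ} (h : ρ.Related i j) : ρ.Related j i :=
  ⟨h.2.1, h.1, ρ.rel.symm h.2.2⟩

theorem EqRel.Related.trans {i j m : ℕ} (h : ρ.Related i j) (h' : ρ.Related j m) :
    ρ.Related i m :=
  ⟨h.1, h'.2.1, ρ.rel.trans h.2.2 h'.2.2⟩

theorem EqRel.related_coe (i j : Fin ρ.length) : ρ.Related i j ↔ ρ.rel i j :=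
  ⟨fun h => h.2.2, fun h => ⟨i.2, j.2, h⟩⟩

/-- Each point is coloured by the least element of its class. With colourings, gluing becomes a
renaming of colours. -/
theorem EqRel.exists_colouring (ρ : EqRel) :
    ∃ f : ℕ → ℕ, ∀ i < ρ.length, ∀ j < ρ.length, ρ.Related i j ↔ f i = f j := by
  refine ⟨fun i => sInf {j | ρ.Related i j}, fun i hi j hj => ⟨fun h => ?_, fun h => ?_⟩⟩
  · have : {m | ρ.Related i m} = {m | ρ.Related j m} :=
      Set.ext fun m => ⟨fun h' => h.symm.trans h', fun h' => h.trans h'⟩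
    simp only [this]
  · have hi' : ρ.Related i (sInf {m | ρ.Related i m}) :=
      Nat.sInf_mem (s := {m | ρ.Related i m}) ⟨i, EqRel.related_refl hi⟩
    have hj' : ρ.Related j (sInf {m | ρ.Related j m}) :=
      Nat.sInf_mem (s := {m | ρ.Related j m}) ⟨j, EqRel.related_refl hj⟩
    simp only at h
    rw [h] at hi'
    exact hi'.trans hj'.symm

/-- The equivalence relation on `n` points whose classes are the colour classes of `f`. -/
def EqRel.ofColouring (n : ℕ) (hn : 0 < n) (f : ℕ → ℕ) : EqRel :=
  ⟨n, hn, Setoid.ker fun i : Fin n => f i⟩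

theorem EqRel.related_ofColouring {n : ℕ} {hn : 0 < n} {f : ℕ → ℕ} {i j : ℕ} (hi : i < n)
    (hj : j < n) : (EqRel.ofColouring n hn f).Related i j ↔ f i = f j :=
  ⟨fun h => h.2.2, fun h => ⟨hi, hj, h⟩⟩

/-- `σ` is the restriction of `ρ` to the points `k, …, k + σ.length - 1`. -/
def OccursAt (σ ρ : EqRel) (k : ℕ) : Prop :=
  k + σ.length ≤ ρ.length ∧
    ∀ i < σ.length, ∀ j < σ.length, σ.Related i j ↔ ρ.Related (k + i) (k + j)

theorem le_iff_exists_occursAt : σ ≤ ρ ↔ ∃ k, OccursAt σ ρ k := by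
  constructor
  · rintro ⟨f, ⟨k, hk⟩, hf⟩
    refine ⟨k, ?_, fun i hi j hj => ?_⟩
    · have h := hk ⟨σ.length - 1, by have := σ.pos; omega⟩
      have := (f ⟨σ.length - 1, by have := σ.pos; omega⟩).isLt
      have := σ.pos
      simp only at h
      omega
    · have h := hf ⟨i, hi⟩ ⟨j, hj⟩
      rw [← EqRel.related_coe, ← EqRel.related_coe, hk, hk] at h
      exact h
  · rintro ⟨k, hk, h⟩
    refine ⟨fun i => ⟨k + i, by omega⟩, ⟨k, fun i => rfl⟩, fun i j => ?_⟩
    rw [← EqRel.related_coe, ← EqRel.related_coe]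
    exact h i i.2 j j.2

theorem OccursAt.refl (σ : EqRel) : OccursAt σ σ 0 :=
  ⟨by simp, fun _ _ _ _ => by simp⟩

theorem OccursAt.trans (h : OccursAt σ τ k) (h' : OccursAt τ ρ l) : OccursAt σ ρ (l + k) := by
  have := h.1
  refine ⟨by have := h'.1; omega, fun i hi j hj => ?_⟩
  rw [h.2 i hi j hj, h'.2 _ (by omega) _ (by omega), add_assoc, add_assoc]

theorem OccursAt.of_add (h : OccursAt σ ρ (l + k)) (h' : OccursAt τ ρ l)
    (hle : k + σ.length ≤ τ.length) : OccursAt σ τ k := by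
  refine ⟨hle, fun i hi j hj => ?_⟩
  rw [h.2 i hi j hj, h'.2 _ (by omega) _ (by omega), add_assoc, add_assoc]

theorem EqRel.ext_related (hl : σ.length = τ.length)
    (h : ∀ i < σ.length, ∀ j < σ.length, σ.Related i j ↔ τ.Related i j) : σ = τ :=
  le_antisymm
    (le_iff_exists_occursAt.2 ⟨0, by omega, fun i hi j hj => by simpa using h i hi j hj⟩)
    (le_iff_exists_occursAt.2
      ⟨0, by omega, fun i hi j hj => by simpa using (h i (hl ▸ hi) j (hl ▸ hj)).symm⟩)

theorem OccursAt.eq (h : OccursAt σ ρ k) (h' : OccursAt τ ρ k) (hl : σ.length = τ.length) :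
    σ = τ :=
  EqRel.ext_related hl fun i hi j hj => by
    rw [h.2 i hi j hj, h'.2 i (hl ▸ hi) j (hl ▸ hj)]

theorem exists_occursAt {m : ℕ} (hm : 0 < m) (h : k + m ≤ ρ.length) :
    ∃ σ : EqRel, σ.length = m ∧ OccursAt σ ρ k :=
  ⟨⟨m, hm, restrict ρ.rel k m h⟩, rfl, h, fun _ hi _ hj =>
    ⟨fun h' => ⟨_, _, h'.2.2⟩, fun h' => ⟨hi, hj, h'.2.2⟩⟩⟩

/-- Two equivalence relations that agree on an overlap have a common extension. -/
theorem exists_amalgam (hσ : l ≤ σ.length) (hτ : l ≤ τ.length)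
    (h : ∀ i < l, ∀ j < l,
      σ.Related (σ.length - l + i) (σ.length - l + j) ↔ τ.Related i j) :
    ∃ θ : EqRel, θ.length = σ.length + τ.length - l ∧ OccursAt σ θ 0 ∧
      OccursAt τ θ (σ.length - l) := by
  obtain ⟨f, hf⟩ := σ.exists_colouring
  obtain ⟨g, hg⟩ := τ.exists_colouring
  set d := σ.length - l with hd
  have hfg : ∀ i < l, ∀ j < l, f (d + i) = f (d + j) ↔ g i = g j := fun i hi j hj => by
    rw [← hf _ (by omega) _ (by omega), ← hg _ (by omega) _ (by omega), h i hi j hj]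
  obtain ⟨M, hM⟩ : ∃ M, ∀ i < σ.length, f i < M := by
    refine ⟨(Finset.range σ.length).sup f + 1, fun i hi => Nat.lt_succ_of_le ?_⟩
    exact Finset.le_sup (f := f) (Finset.mem_range.2 hi)
  classical
  -- The colours of `τ` are renamed: a colour seen on the overlap becomes the colour that `σ` has
  -- there, and any other is moved to `M` or beyond, clear of all colours of `σ`. Hence `φ` is
  -- injective and creates no unwanted identification.
  let φ : ℕ → ℕ := fun x => if hx : ∃ c < l, g c = x then f (d + hx.choose) else M + x
  have hφ : ∀ c < l, φ (g c) = f (d + c) := fun c hc => by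
    have hx : ∃ c' < l, g c' = g c := ⟨c, hc, rfl⟩
    simp only [φ, dif_pos hx]
    exact (hfg _ hx.choose_spec.1 _ hc).2 hx.choose_spec.2
  have hφ' : ∀ x, (¬ ∃ c < l, g c = x) → φ x = M + x := fun x hx => dif_neg hx
  have hinj : Function.Injective φ := fun x y hxy => by
    by_cases hx : ∃ c < l, g c = x <;> by_cases hy : ∃ c < l, g c = y
    · obtain ⟨c, hc, rfl⟩ := hx
      obtain ⟨c', hc', rfl⟩ := hy
      rw [hφ c hc, hφ c' hc'] at hxy
      exact (hfg _ hc _ hc').1 hxy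
    · obtain ⟨c, hc, rfl⟩ := hx
      rw [hφ c hc, hφ' y hy] at hxy
      have := hM (d + c) (by omega)
      omega
    · obtain ⟨c, hc, rfl⟩ := hy
      rw [hφ c hc, hφ' x hx] at hxy
      have := hM (d + c) (by omega)
      omega
    · rw [hφ' x hx, hφ' y hy] at hxy
      omega
  let e : ℕ → ℕ := fun i => if i < σ.length then f i else φ (g (i - d))
  have he : ∀ k < τ.length, e (d + k) = φ (g k) := fun k hk => by
    by_cases hlt : d + k < σ.length
    · simp only [e, if_pos hlt]
      exact (hφ k (by omega)).symm
    · simp only [e, if_neg hlt, Nat.add_sub_cancel_left]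
  have hpos := σ.pos
  have hlen : (EqRel.ofColouring (σ.length + τ.length - l) (by omega) e).length =
    σ.length + τ.length - l := rfl
  refine ⟨EqRel.ofColouring (σ.length + τ.length - l) (by omega) e, rfl,
    ⟨by omega, fun i hi j hj => ?_⟩, ⟨by omega, fun i hi j hj => ?_⟩⟩
  · rw [EqRel.related_ofColouring (by omega) (by omega), hf i hi j hj]
    simp [e, hi, hj]
  · rw [EqRel.related_ofColouring (by omega) (by omega), hg i hi j hj, he i hi, he j hj,
      hinj.eq_iff]

end EquivalenceRelations

/-! ### Members of the avoidance set and their paths in the factor graph -/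

section Paths

variable {B : Finset EqRel} {ρ σ τ θ : EqRel}

/-- `w` is the path of `ρ` in the factor graph. -/
def IsPath (ρ : EqRel) (w : List (level B)) : Prop :=
  ρ.length + 1 = w.length + maxLength B ∧
    ∀ (i : ℕ) (ν : level B), w[i]? = some ν → OccursAt ν.1 ρ i

theorem length_level (ν : level B) : ν.1.length = maxLength B := ν.2.2

theorem maxLength_pos (ν : level B) : 0 < maxLength B := length_level ν ▸ ν.1.pos

instance : Finite (level B) := by
  refine Finite.of_injective
    (fun (ν : level B) (i j : Fin (maxLength B)) => ν.1.Related i j) fun μ ν h => ?_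
  refine Subtype.ext (EqRel.ext_related ((length_level μ).trans (length_level ν).symm) ?_)
  intro i hi j hj
  rw [length_level] at hi hj
  exact iff_of_eq (congrFun (congrFun h ⟨i, hi⟩) ⟨j, hj⟩)

theorem factorGraph_adj_iff {μ ν : level B} :
    (factorGraph B).Adj μ ν ↔ ∀ i < maxLength B - 1, ∀ j < maxLength B - 1,
      μ.1.Related (1 + i) (1 + j) ↔ ν.1.Related i j := by
  have hμ := length_level μ
  have hν := length_level ν
  have hb := maxLength_pos μ
  constructor
  · rintro ⟨h₁, h₂, h⟩ i hi j hj
    have : μ.1.rel ⟨1 + i, by omega⟩ ⟨1 + j, by omega⟩ ↔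
        ν.1.rel ⟨0 + i, by omega⟩ ⟨0 + j, by omega⟩ :=
      Setoid.ext_iff.1 h ⟨i, hi⟩ ⟨j, hj⟩
    rw [← EqRel.related_coe, ← EqRel.related_coe] at this
    simpa using this
  · intro h
    refine ⟨by omega, by omega, Setoid.ext fun i j => ?_⟩
    change μ.1.rel ⟨1 + i, by omega⟩ ⟨1 + j, by omega⟩ ↔
      ν.1.rel ⟨0 + i, by omega⟩ ⟨0 + j, by omega⟩
    rw [← EqRel.related_coe, ← EqRel.related_coe]
    simpa using h i i.2 j j.2

theorem mem_Av_of_le (hρ : ρ ∈ Av (B : Set EqRel)) (h : σ ≤ ρ) : σ ∈ Av (B : Set EqRel) :=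
  isLowerSet_Av _ h hρ

theorem exists_isPath (hb : 0 < maxLength B) (hρ : ρ ∈ Av (B : Set EqRel))
    (hl : maxLength B ≤ ρ.length) : ∃ w : List (level B), w ≠ [] ∧ IsPath ρ w := by
  have h : ∀ i : Fin (ρ.length + 1 - maxLength B), ∃ ν : level B, OccursAt ν.1 ρ i := fun i => by
    obtain ⟨ν, hν, ho⟩ := exists_occursAt (ρ := ρ) (k := i) hb (by omega)
    exact ⟨⟨ν, mem_Av_of_le hρ (le_iff_exists_occursAt.2 ⟨_, ho⟩), hν⟩, ho⟩
  choose f hf using h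
  refine ⟨List.ofFn f, ?_, by simp; omega, fun i ν hν => ?_⟩
  · rw [ne_eq, List.ofFn_eq_nil_iff]
    omega
  · rw [List.getElem?_ofFn] at hν
    split_ifs at hν with hi
    obtain rfl := Option.some.inj hν
    exact hf ⟨i, hi⟩

theorem IsPath.getElem?_of_occursAt {W : List (level B)} (hW : IsPath θ W) {i : ℕ} {ν : level B}
    (h : OccursAt ν.1 θ i) : W[i]? = some ν := by
  have h₁ := hW.1
  have h₂ := h.1
  rw [length_level] at h₂
  have hi : i < W.length := by omega
  have h₃ := hW.2 i W[i] (List.getElem?_eq_getElem hi)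
  rw [List.getElem?_eq_getElem hi]
  exact congrArg some (Subtype.ext (h₃.eq h ((length_level _).trans (length_level _).symm)))

theorem IsPath.getElem?_add {w W : List (level B)} (hw : IsPath ρ w) (hW : IsPath θ W) {k : ℕ}
    (h : OccursAt ρ θ k) {i : ℕ} {ν : level B} (hν : w[i]? = some ν) : W[k + i]? = some ν :=
  hW.getElem?_of_occursAt ((hw.2 i ν hν).trans h)

theorem IsPath.infix {w W : List (level B)} (hw : IsPath ρ w) (hW : IsPath θ W) {k : ℕ}
    (h : OccursAt ρ θ k) : w <:+: W := by
  refine List.infix_iff_getElem?.2 ⟨k, ?_, fun i hi => ?_⟩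
  · have h₁ := hw.1
    have h₂ := hW.1
    have h₃ := h.1
    omega
  · rw [add_comm]
    exact hw.getElem?_add hW h (List.getElem?_eq_getElem hi)

/-- No element of `B` is longer than a window, so an occurrence of it in `ρ` lies within a single
window. The empty list must be excluded: it would only say that `ρ` has `maxLength B - 1` points. -/
theorem IsPath.mem_Av {w : List (level B)} (hw : IsPath ρ w) (hne : w ≠ []) :
    ρ ∈ Av (B : Set EqRel) := by
  intro β hβ hle
  obtain ⟨k, hk⟩ := le_iff_exists_occursAt.1 hle
  have hβl : β.length ≤ maxLength B := Finset.le_sup (f := EqRel.length) hβ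
  have hwl := List.length_pos_iff.2 hne
  have h₁ := hw.1
  have h₂ := hk.1
  -- The window starts at `k`, or is the last one if `k` is too far to the right.
  obtain ⟨m, hm, hmk, hle'⟩ : ∃ m < w.length, m ≤ k ∧ k + β.length ≤ m + maxLength B := by
    by_cases hk' : k < w.length
    · exact ⟨k, hk', le_rfl, by omega⟩
    · exact ⟨w.length - 1, by omega, by omega, by omega⟩
  have ho := hw.2 m w[m] (List.getElem?_eq_getElem hm)
  refine w[m].2.1 β hβ (le_iff_exists_occursAt.2 ⟨k - m, OccursAt.of_add ?_ ho ?_⟩)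
  · rwa [Nat.add_sub_cancel' hmk]
  · rw [length_level]
    omega

theorem IsPath.isChain {w : List (level B)} (hw : IsPath ρ w) :
    w.IsChain (factorGraph B).Adj := by
  rw [List.isChain_iff_getElem]
  intro i hi
  have h₁ := hw.2 i w[i] (List.getElem?_eq_getElem _)
  have h₂ := hw.2 (i + 1) w[i + 1] (List.getElem?_eq_getElem hi)
  rw [factorGraph_adj_iff]
  intro a ha c hc
  rw [h₁.2 _ (by rw [length_level]; omega) _ (by rw [length_level]; omega),
    h₂.2 _ (by rw [length_level]; omega) _ (by rw [length_level]; omega), add_assoc, add_assoc]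

theorem IsPath.singleton (ν : level B) : IsPath ν.1 [ν] := by
  refine ⟨by rw [length_level, List.length_singleton, add_comm], fun i μ h => ?_⟩
  obtain ⟨hi, rfl⟩ := List.getElem?_eq_some_iff.1 h
  obtain rfl : i = 0 := by simpa using hi
  exact .refl _

theorem exists_isPath_pair {μ ν : level B} (h : (factorGraph B).Adj μ ν) :
    ∃ θ, IsPath θ [μ, ν] := by
  have hb := maxLength_pos μ
  have hμ := length_level μ
  have hν := length_level ν
  obtain ⟨θ, hθ, h₁, h₂⟩ := exists_amalgam (σ := μ.1) (τ := ν.1) (l := maxLength B - 1)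
    (by omega) (by omega) (by
      rw [show μ.1.length - (maxLength B - 1) = 1 by omega]
      exact factorGraph_adj_iff.1 h)
  rw [show μ.1.length - (maxLength B - 1) = 1 by omega] at h₂
  refine ⟨θ, by simp; omega, fun i κ hκ => ?_⟩
  match i with
  | 0 => obtain rfl : μ = κ := by simpa using hκ
         exact h₁
  | 1 => obtain rfl : ν = κ := by simpa using hκ
         exact h₂
  | i + 2 => simp at hκ

/-- Paths that meet in a vertex are concatenated by amalgamation. -/
theorem IsPath.exists_append {w₁ w₂ : List (level B)} {x : level B} (hσ : IsPath σ (w₁ ++ [x]))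
    (hτ : IsPath τ (x :: w₂)) :
    ∃ θ, IsPath θ (w₁ ++ x :: w₂) ∧ OccursAt σ θ 0 ∧ OccursAt τ θ w₁.length := by
  have hxl := length_level x
  have hσl := hσ.1
  have hτl := hτ.1
  simp only [List.length_append, List.length_cons, List.length_nil] at hσl hτl
  have hx₁ := hσ.2 w₁.length x (by simp)
  have hx₂ := hτ.2 0 x rfl
  have hd : σ.length - maxLength B = w₁.length := by omega
  obtain ⟨θ, hθ, h₁, h₂⟩ := exists_amalgam (σ := σ) (τ := τ) (l := maxLength B)
    (by omega) (by omega) (fun i hi j hj => by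
      rw [hd, ← hx₁.2 i (by omega) j (by omega), hx₂.2 i (by omega) j (by omega), zero_add,
        zero_add])
  rw [hd] at h₂
  refine ⟨θ, ⟨by simp; omega, fun i ν hν => ?_⟩, h₁, h₂⟩
  rcases lt_or_ge i w₁.length with hi | hi
  · rw [List.getElem?_append_left hi] at hν
    have := (hσ.2 i ν (by rw [List.getElem?_append_left hi, hν])).trans h₁
    rwa [zero_add] at this
  · rw [List.getElem?_append_right hi] at hν
    have := (hτ.2 _ ν hν).trans h₂
    rwa [Nat.add_sub_cancel' hi] at this

/-- An edge is realised by amalgamation of its ends over `maxLength B - 1` points, and longer walks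
by amalgamation over a shared vertex. -/
theorem exists_isPath_of_isChain {w : List (level B)} (hw : w ≠ [])
    (hc : w.IsChain (factorGraph B).Adj) : ∃ θ, IsPath θ w := by
  induction w with
  | nil => exact absurd rfl hw
  | cons x t ih =>
    cases t with
    | nil => exact ⟨x.1, .singleton x⟩
    | cons y t =>
      rw [List.isChain_cons_cons] at hc
      obtain ⟨τ, hτ⟩ := ih (by simp) hc.2
      obtain ⟨σ, hσ⟩ := exists_isPath_pair hc.1
      obtain ⟨θ, hθ, -⟩ := IsPath.exists_append (w₁ := [x]) hσ hτ
      exact ⟨θ, hθ⟩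

/-- Any extension of the path of `ρ` comes from an extension of `ρ`. -/
theorem IsPath.exists_extension {A w C : List (level B)} (hρ : IsPath ρ w) (hw : w ≠ [])
    (hc : (A ++ w ++ C).IsChain (factorGraph B).Adj) :
    ∃ θ, IsPath θ (A ++ w ++ C) ∧ OccursAt ρ θ A.length := by
  obtain ⟨x, t, rfl⟩ := List.exists_cons_of_ne_nil hw
  obtain ⟨σ, hσ⟩ := exists_isPath_of_isChain (w := A ++ [x]) (by simp)
    (List.isChain_split.1 hc.left_of_append).1
  obtain ⟨θ₁, hθ₁, -, h₁⟩ := hσ.exists_append hρ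
  obtain ⟨s, y, hs⟩ : ∃ s y, A ++ x :: t = s ++ [y] :=
    ⟨_, _, (List.dropLast_append_getLast (by simp)).symm⟩
  rw [hs] at hθ₁ hc ⊢
  rw [List.append_assoc, List.singleton_append] at hc ⊢
  obtain ⟨τ, hτ⟩ := exists_isPath_of_isChain (by simp) (List.isChain_split.1 hc).2
  obtain ⟨θ, hθ, h₂, -⟩ := hθ₁.exists_append hτ
  exact ⟨θ, hθ, by simpa using h₁.trans h₂⟩

theorem IsPath.exists_extension_of_infix {w W : List (level B)} (hρ : IsPath ρ w) (hw : w ≠ [])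
    (hc : W.IsChain (factorGraph B).Adj) (h : w <:+: W) : ∃ θ, IsPath θ W ∧ ρ ≤ θ := by
  obtain ⟨A, C, rfl⟩ := h
  obtain ⟨θ, hθ, ho⟩ := hρ.exists_extension hw hc
  exact ⟨θ, hθ, le_iff_exists_occursAt.2 ⟨_, ho⟩⟩

/-! ### Ambiguity -/

theorem getLast?_windows_eq_some_iff {b : ℕ} (hb : 0 < b) (h : b ≤ ρ.length) {ν : EqRel}
    (hν : ν.length = b) :
    (windows ρ b hb h).getLast? = some ν ↔ OccursAt ν ρ (ρ.length - b) := by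
  have hlast : OccursAt ⟨b, hb, restrict ρ.rel (ρ.length - b) b (by omega)⟩ ρ (ρ.length - b) :=
    ⟨by simp only; omega, fun i hi j hj =>
      ⟨fun h' => ⟨_, _, h'.2.2⟩, fun h' => ⟨hi, hj, h'.2.2⟩⟩⟩
  have e : (windows ρ b hb h).getLast? =
      some ⟨b, hb, restrict ρ.rel (ρ.length - b) b (by omega)⟩ := by
    rw [List.getLast?_eq_getElem?, windows, List.getElem?_ofFn]
    simp
  rw [e]
  constructor
  · intro h'
    exact Option.some.inj h' ▸ hlast
  · intro h'
    exact congrArg some (hlast.eq h' hν.symm)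

theorem hasInactiveClass_iff {b : ℕ} :
    HasInactiveClass b σ ↔
      ∃ i < σ.length, ∀ j, σ.Related i j → j + (b - 1) < σ.length := by
  constructor
  · rintro ⟨c, ⟨y, rfl⟩, hc⟩
    exact ⟨y, y.2, fun j hj => hc ⟨j, hj.lt_right⟩ hj.symm.2.2⟩
  · rintro ⟨i, hi, h⟩
    exact ⟨_, ⟨⟨i, hi⟩, rfl⟩, fun j hj => h j ⟨hi, j.2, σ.rel.symm hj⟩⟩

theorem isSpecial_iff {ν : EqRel} :
    IsSpecial ν ↔ ∀ i, ν.Related i (ν.length - 1) → i = ν.length - 1 :=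
  ⟨fun h i hi => h ⟨i, hi.lt_left⟩ hi.2.2, fun h i hi => h i ⟨i.2, _, hi⟩⟩

theorem isAmbiguous_iff {ν : level B} :
    IsAmbiguous B ν ↔ IsSpecial ν.1 ∧ ∃ (σ : EqRel) (w : List (level B)) (μ : level B),
      IsPath σ (w ++ [μ]) ∧ (factorGraph B).Adj μ ν ∧ HasInactiveClass (maxLength B) σ := by
  refine and_congr_right fun _ => ⟨?_, ?_⟩
  · rintro ⟨μ, hadj, σ, hσ, hb, hl, hin, hlast⟩
    rw [getLast?_windows_eq_some_iff _ _ (length_level μ)] at hlast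
    obtain ⟨w, hw, hp⟩ := exists_isPath hb hσ hl
    have h₁ := hp.1
    have hμ := hp.getElem?_of_occursAt hlast
    rw [show σ.length - maxLength B = w.length - 1 by omega, ← List.getLast?_eq_getElem?] at hμ
    obtain ⟨w', rfl⟩ := List.getLast?_eq_some_iff.1 hμ
    exact ⟨σ, w', μ, hp, hadj, hin⟩
  · rintro ⟨σ, w, μ, hp, hadj, hin⟩
    have h₁ := hp.1
    simp only [List.length_append, List.length_singleton] at h₁
    have hl : maxLength B ≤ σ.length := by omega
    refine ⟨μ, hadj, σ, hp.mem_Av (by simp), maxLength_pos μ, hl, hin, ?_⟩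
    rw [getLast?_windows_eq_some_iff _ _ (length_level μ)]
    rw [show σ.length - maxLength B = w.length by omega]
    exact hp.2 _ μ (by simp)

/-- If there are no ambiguous vertices, then an equivalence relation is determined by its path. -/
theorem IsPath.eq_of_not_isAmbiguous (hB : ∀ ν : level B, ¬ IsAmbiguous B ν)
    {w : List (level B)} (hw : w ≠ []) (hσ : IsPath σ w) (hτ : IsPath τ w) : σ = τ := by
  induction w using List.reverseRecOn generalizing σ τ with
  | nil => exact absurd rfl hw
  | append_singleton w ν ih =>
    have hb := maxLength_pos ν
    have hσl := hσ.1
    have hτl := hτ.1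
    have hνσ := hσ.2 w.length ν (by simp)
    have hντ := hτ.2 w.length ν (by simp)
    have hνl := length_level ν
    simp only [List.length_append, List.length_singleton] at hσl hτl
    rcases List.eq_nil_or_concat' w with rfl | ⟨w, μ, rfl⟩
    · simp only [List.length_nil] at *
      exact (hνσ.eq (.refl σ) (by omega)).symm.trans (hντ.eq (.refl τ) (by omega))
    · have hprefix : ∀ {κ : EqRel}, IsPath κ (w ++ [μ] ++ [ν]) →
          ∃ κ' : EqRel, κ'.length + 1 = κ.length ∧ OccursAt κ' κ 0 ∧
            IsPath κ' (w ++ [μ]) := fun {κ} hκ => by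
        have h₁ := hκ.1
        simp only [List.length_append, List.length_singleton] at h₁
        obtain ⟨κ', hl, ho⟩ := exists_occursAt (ρ := κ) (k := 0) (m := κ.length - 1)
          (by omega) (by omega)
        refine ⟨κ', by omega, ho, by simp; omega, fun i η hη => ?_⟩
        have hi := (List.getElem?_eq_some_iff.1 hη).1
        have := hκ.2 i η (by rw [List.getElem?_append_left hi, hη])
        simp only [List.length_append, List.length_singleton] at hi
        exact OccursAt.of_add (by rwa [zero_add]) ho (by rw [length_level]; omega)
      obtain ⟨ρ, hρl, hρσ, hρ⟩ := hprefix hσ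
      obtain ⟨ρ', hρl', hρτ, hρ'⟩ := hprefix hτ
      obtain rfl := ih (by simp) hρ hρ'
      have hadj : (factorGraph B).Adj μ ν := by
        have := hσ.isChain
        rw [List.append_assoc, List.singleton_append, List.isChain_split] at this
        simpa using this.2
      simp only [List.length_append, List.length_singleton] at *
      -- The first points of `σ` and `τ` form the same `ρ`, so only the class of the new last point
      -- is in question.
      have hlast : ∀ i < ρ.length, σ.Related i ρ.length ↔ τ.Related i ρ.length := by
        intro i hi
        by_cases hs : IsSpecial ν.1
        -- Without inactive classes, the class of `i` has a point `j` inside the last window, where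
        -- the special last point is alone.
        · have hin : ¬ HasInactiveClass (maxLength B) ρ := fun hin =>
            hB ν (isAmbiguous_iff.2 ⟨hs, ρ, w, μ, hρ, hadj, hin⟩)
          rw [hasInactiveClass_iff] at hin
          push Not at hin
          obtain ⟨j, hij, hj⟩ := hin i hi
          have hjl := hij.lt_right
          rw [isSpecial_iff] at hs
          have key : ∀ κ : EqRel, OccursAt ρ κ 0 → OccursAt ν.1 κ (w.length + 1) →
              ¬ κ.Related i ρ.length := by
            intro κ h₀ h₁ h₂
            have h₃ : κ.Related i j := by simpa using (h₀.2 i hi j hjl).1 hij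
            have h₄ := h₃.symm.trans h₂
            obtain ⟨c, hc⟩ : ∃ c, j = w.length + 1 + c := ⟨j - (w.length + 1), by omega⟩
            rw [hc, show ρ.length = w.length + 1 + (ν.1.length - 1) by omega,
              ← h₁.2 c (by omega) _ (by omega)] at h₄
            have := hs c h₄
            omega
          exact iff_of_false (key σ hρσ hνσ) (key τ hρτ hντ)
        -- Here the last window ties the new point to an earlier point `a`, whose class in `ρ` is
        -- known.
        · rw [isSpecial_iff] at hs
          push Not at hs
          obtain ⟨a, ha, hne⟩ := hs
          have hal := ha.lt_left
          have key : ∀ κ : EqRel, OccursAt ρ κ 0 → OccursAt ν.1 κ (w.length + 1) →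
              (κ.Related i ρ.length ↔ ρ.Related i (w.length + 1 + a)) := by
            intro κ h₀ h₁
            have h₂ := (h₁.2 a hal _ (by omega)).1 ha
            rw [show w.length + 1 + (ν.1.length - 1) = ρ.length by omega] at h₂
            rw [h₀.2 i hi _ (by omega), zero_add, zero_add]
            exact ⟨fun h => h.trans h₂.symm, fun h => h.trans h₂⟩
          rw [key σ hρσ hνσ, key τ hρτ hντ]
      refine EqRel.ext_related (by omega) fun i hi j hj => ?_
      rcases lt_or_ge i ρ.length with hi' | hi' <;> rcases lt_or_ge j ρ.length with hj' | hj'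
      · have h₁ := hρσ.2 i hi' j hj'
        have h₂ := hρτ.2 i hi' j hj'
        rw [zero_add, zero_add] at h₁ h₂
        rw [← h₁, ← h₂]
      · obtain rfl : j = ρ.length := by omega
        exact hlast i hi'
      · obtain rfl : i = ρ.length := by omega
        exact ⟨fun h => ((hlast j hj').1 h.symm).symm, fun h => ((hlast j hj').2 h.symm).symm⟩
      · obtain rfl : i = ρ.length := by omega
        obtain rfl : j = ρ.length := by omega
        exact iff_of_true (EqRel.related_refl hi) (EqRel.related_refl (by omega))

/-- A path is continued to a special vertex by a new last point of any colour that does not occur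
at the largest `maxLength B - 1` points. -/
theorem IsPath.concat_ofColouring {w : List (level B)} {μ ν : level B} {f : ℕ → ℕ} {c : ℕ}
    (hσ : IsPath σ (w ++ [μ])) (hadj : (factorGraph B).Adj μ ν) (hs : IsSpecial ν.1)
    (hf : ∀ i < σ.length, ∀ j < σ.length, σ.Related i j ↔ f i = f j)
    (hc : ∀ j < σ.length, f j = c → j + (maxLength B - 1) < σ.length) :
    IsPath (EqRel.ofColouring (σ.length + 1) (Nat.succ_pos _) (Function.update f σ.length c))
      (w ++ [μ] ++ [ν]) := by
  have hb := maxLength_pos ν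
  have hσl := hσ.1
  have hνl := length_level ν
  have hμl := length_level μ
  simp only [List.length_append, List.length_singleton] at hσl
  set θ := EqRel.ofColouring (σ.length + 1) (Nat.succ_pos _) (Function.update f σ.length c)
    with hθ
  have hθl : θ.length = σ.length + 1 := rfl
  have hlt : ∀ i < σ.length, Function.update f σ.length c i = f i := fun i hi =>
    Function.update_of_ne hi.ne _ _
  have hσθ : OccursAt σ θ 0 := by
    refine ⟨by omega, fun i hi j hj => ?_⟩
    rw [hθ, EqRel.related_ofColouring (by omega) (by omega), zero_add, zero_add, hlt i hi,
      hlt j hj, hf i hi j hj]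
  refine ⟨by simp; omega, fun i κ hκ => ?_⟩
  rcases lt_or_ge i (w ++ [μ]).length with hi | hi
  · rw [List.getElem?_append_left hi] at hκ
    simpa using (hσ.2 i κ hκ).trans hσθ
  · have hi' := (List.getElem?_eq_some_iff.1 hκ).1
    simp only [List.length_append, List.length_singleton] at hi hi'
    obtain rfl : i = w.length + 1 := by omega
    obtain rfl : ν = κ := by
      rw [List.getElem?_append_right (by simp)] at hκ
      simpa using hκ
    have hμ := hσ.2 w.length μ (by simp)
    rw [factorGraph_adj_iff] at hadj
    rw [isSpecial_iff] at hs
    -- Within the last window the new point is related to no other: in `ν` because `ν` is special,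
    -- in `θ` by the choice of `c`.
    have hmix : ∀ i < maxLength B - 1,
        ν.1.Related i (maxLength B - 1) ↔
          θ.Related (w.length + 1 + i) (w.length + 1 + (maxLength B - 1)) := by
      intro i hi
      refine iff_of_false (fun h => ?_) fun h => ?_
      · have := hs i (by rwa [hνl])
        omega
      · rw [hθ, EqRel.related_ofColouring (by omega) (by omega), hlt _ (by omega),
          show w.length + 1 + (maxLength B - 1) = σ.length by omega, Function.update_self] at h
        have := hc _ (by omega) h
        omega
    refine ⟨by omega, fun i hi j hj => ?_⟩
    rcases lt_or_ge i (maxLength B - 1) with hi' | hi' <;>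
      rcases lt_or_ge j (maxLength B - 1) with hj' | hj'
    · have h₀ := hσθ.2 (w.length + (1 + i)) (by omega) (w.length + (1 + j)) (by omega)
      rw [← hadj i hi' j hj', hμ.2 _ (by omega) _ (by omega), h₀]
      simp only [zero_add, add_assoc]
    · obtain rfl : j = maxLength B - 1 := by omega
      exact hmix i hi'
    · obtain rfl : i = maxLength B - 1 := by omega
      exact ⟨fun h => ((hmix j hj').1 h.symm).symm, fun h => ((hmix j hj').2 h.symm).symm⟩
    · obtain rfl : i = maxLength B - 1 := by omega
      obtain rfl : j = maxLength B - 1 := by omega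
      exact iff_of_true (EqRel.related_refl (by omega)) (EqRel.related_refl (by omega))

/-- An ambiguous vertex is the end of the path of two different equivalence relations. -/
theorem IsAmbiguous.exists_ne {ν : level B} (h : IsAmbiguous B ν) :
    ∃ (σ τ : EqRel) (w : List (level B)), w ≠ [] ∧ IsPath σ w ∧ IsPath τ w ∧ σ ≠ τ := by
  obtain ⟨hs, σ, w, μ, hσ, hadj, hin⟩ := isAmbiguous_iff.1 h
  obtain ⟨i, hi, hia⟩ := hasInactiveClass_iff.1 hin
  obtain ⟨f, hf⟩ := σ.exists_colouring
  obtain ⟨c, hc⟩ := Infinite.exists_notMem_finset ((Finset.range σ.length).image f)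
  have hc' : ∀ j < σ.length, f j ≠ c := fun j hj e =>
    hc (Finset.mem_image.2 ⟨j, Finset.mem_range.2 hj, e⟩)
  -- The new point either joins the inactive class of `i` or, with the unused colour `c`, forms a
  -- class of its own.
  refine ⟨_, _, _, by simp,
    hσ.concat_ofColouring hadj hs hf (c := f i) fun j hj e => hia j ((hf i hi j hj).2 e.symm),
    hσ.concat_ofColouring hadj hs hf (c := c) fun j hj e => absurd e (hc' j hj), fun e => ?_⟩
  have h₁ : (EqRel.ofColouring (σ.length + 1) (Nat.succ_pos _)
      (Function.update f σ.length (f i))).Related i σ.length := by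
    rw [EqRel.related_ofColouring (by omega) (by omega), Function.update_self,
      Function.update_of_ne hi.ne]
  rw [e, EqRel.related_ofColouring (by omega) (by omega), Function.update_self,
    Function.update_of_ne hi.ne] at h₁
  exact hc' i hi h₁

end Paths

/-- Atomicity is the joint embedding property. -/
theorem isAtomicSet_iff_directedOn {X : Type*} [PartialOrder X] {C : Set X} (hC : IsLowerSet C) :
    IsAtomicSet C ↔ DirectedOn (· ≤ ·) C := by
  constructor
  · intro h x hx y hy
    by_contra! hxy
    -- The members not above `x` and those not above `y` cover `C` if no member is above both.
    refine h ⟨{z ∈ C | ¬ x ≤ z}, {z ∈ C | ¬ y ≤ z},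
      fun a b hba ha => ⟨hC hba ha.1, fun h' => ha.2 (h'.trans hba)⟩,
      fun a b hba ha => ⟨hC hba ha.1, fun h' => ha.2 (h'.trans hba)⟩,
      ⟨fun z hz => hz.1, fun h' => (h' hx).2 le_rfl⟩,
      ⟨fun z hz => hz.1, fun h' => (h' hy).2 le_rfl⟩, ?_⟩
    ext z
    constructor
    · intro hz
      by_cases hxz : x ≤ z
      · exact .inr ⟨hz, hxy z hz hxz⟩
      · exact .inl ⟨hz, hxz⟩
    · rintro (hz | hz) <;> exact hz.1
  · rintro h ⟨D, E, hD, hE, hDC, hEC, rfl⟩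
    obtain ⟨x, hx, hxD⟩ := Set.exists_of_ssubset hDC
    obtain ⟨y, hy, hyE⟩ := Set.exists_of_ssubset hEC
    obtain ⟨z, hz | hz, hxz, hyz⟩ := h x hx y hy
    · exact hxD (hD hxz hz)
    · exact hyE (hE hyz hz)

/-! ### Joint embedding of members and of walks -/

section Main

variable {B : Finset EqRel}

theorem jointWalks_of_directedOn (hC : DirectedOn (· ≤ ·) (Av (B : Set EqRel))) :
    JointWalks (factorGraph B).Adj := by
  intro w₁ w₂ n₁ n₂ h₁ h₂
  obtain ⟨σ, hσ⟩ := exists_isPath_of_isChain n₁ h₁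
  obtain ⟨τ, hτ⟩ := exists_isPath_of_isChain n₂ h₂
  obtain ⟨θ, hθ, hσθ, hτθ⟩ := hC σ (hσ.mem_Av n₁) τ (hτ.mem_Av n₂)
  obtain ⟨k, hk⟩ := le_iff_exists_occursAt.1 hσθ
  obtain ⟨l, hl⟩ := le_iff_exists_occursAt.1 hτθ
  obtain ⟨x, hx⟩ := List.exists_mem_of_ne_nil w₁ n₁
  obtain ⟨W, -, hW⟩ := exists_isPath (maxLength_pos x) hθ (by
    have := hσ.1
    have := hσθ.length_le
    have := List.length_pos_iff.2 n₁
    omega)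
  exact ⟨W, hW.isChain, hσ.infix hW hk, hτ.infix hW hl⟩

/-- In an atomic set whose factor graph is not strongly connected, an equivalence relation is
determined by its path, because the path can be extended over an edge that no walk uses twice. -/
theorem IsPath.eq_of_directedOn (hC : DirectedOn (· ≤ ·) (Av (B : Set EqRel)))
    (hS : ¬ StronglyConnected (factorGraph B)) {σ τ : EqRel} {w : List (level B)} (hw : w ≠ [])
    (hσ : IsPath σ w) (hτ : IsPath τ w) : σ = τ := by
  have hJ := jointWalks_of_directedOn hC
  obtain ⟨p, q, hpq, hqp⟩ := hJ.exists_not_reach hS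
  obtain ⟨A, D, hc, L, R, hLR⟩ := (hJ.isPivot hpq hqp).exists_extension hw hσ.isChain
  obtain ⟨σ', hσ', hoσ⟩ := hσ.exists_extension hw (hLR ▸ hc)
  obtain ⟨τ', hτ', hoτ⟩ := hτ.exists_extension hw (hLR ▸ hc)
  rw [hLR] at hσ' hτ'
  obtain ⟨θ, hθ, hσθ, hτθ⟩ := hC σ' (hσ'.mem_Av (by simp)) τ' (hτ'.mem_Av (by simp))
  obtain ⟨k, hk⟩ := le_iff_exists_occursAt.1 hσθ
  obtain ⟨l, hl⟩ := le_iff_exists_occursAt.1 hτθ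
  have hlen := hσ'.1
  have hlen' := hτ'.1
  obtain ⟨W, -, hW⟩ := exists_isPath (maxLength_pos p) hθ (by
    have := hσθ.length_le
    simp only [List.length_append, List.length_cons] at hlen
    omega)
  have hp : (A ++ p :: q :: D)[A.length]? = some p := by simp
  have hq : (A ++ p :: q :: D)[A.length + 1]? = some q := by simp
  -- The edge `(p, q)` occurs once in the path of `θ`, so `σ'` and `τ'` sit at the same place of
  -- `θ`.
  have e := edge_index_unique hW.isChain hqp (hσ'.getElem?_add hW hk hp)
    (hσ'.getElem?_add hW hk hq) (hτ'.getElem?_add hW hl hp) (hτ'.getElem?_add hW hl hq)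
  obtain rfl : k = l := by omega
  obtain rfl := hk.eq hl (by omega)
  exact hoσ.eq hoτ (by have := hσ.1; have := hτ.1; omega)

/-- Short members have no path; the condition on them replaces each by a member of length `maxLength
B` above it. -/
theorem directedOn_of_common_extension (hb : 0 < maxLength B)
    (hC : ∀ σ ∈ Av (B : Set EqRel), σ.length < maxLength B → ∃ ρ ∈ level B, σ ≤ ρ)
    (h : ∀ (σ τ : EqRel) (w₁ w₂ : List (level B)), w₁ ≠ [] → w₂ ≠ [] → IsPath σ w₁ →
      IsPath τ w₂ → ∃ (θ : EqRel) (w : List (level B)), w ≠ [] ∧ IsPath θ w ∧ σ ≤ θ ∧ τ ≤ θ) :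
    DirectedOn (· ≤ ·) (Av (B : Set EqRel)) := by
  have hlong : ∀ σ ∈ Av (B : Set EqRel),
      ∃ (σ' : EqRel) (w : List (level B)), σ ≤ σ' ∧ w ≠ [] ∧ IsPath σ' w := by
    intro σ hσ
    rcases lt_or_ge σ.length (maxLength B) with hl | hl
    · obtain ⟨ρ, hρ, hle⟩ := hC σ hσ hl
      exact ⟨ρ, [⟨ρ, hρ⟩], hle, by simp, .singleton ⟨ρ, hρ⟩⟩
    · obtain ⟨w, hw, hp⟩ := exists_isPath hb hσ hl
      exact ⟨σ, w, le_rfl, hw, hp⟩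
  intro σ hσ τ hτ
  obtain ⟨σ', w₁, h₁, n₁, p₁⟩ := hlong σ hσ
  obtain ⟨τ', w₂, h₂, n₂, p₂⟩ := hlong τ hτ
  obtain ⟨θ, w, hw, hp, h₃, h₄⟩ := h σ' τ' w₁ w₂ n₁ n₂ p₁ p₂
  exact ⟨θ, hp.mem_Av hw, h₁.trans h₃, h₂.trans h₄⟩

/-- A walk from the last window of `σ` to the first window of `τ` lets both be amalgamated in turn.
Ambiguity does no harm, since the two are never required to share one place in the walk. -/
theorem StronglyConnected.exists_common_extension (hS : StronglyConnected (factorGraph B))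
    {σ τ : EqRel} {w₁ w₂ : List (level B)} (n₁ : w₁ ≠ []) (n₂ : w₂ ≠ []) (hσ : IsPath σ w₁)
    (hτ : IsPath τ w₂) :
    ∃ (θ : EqRel) (w : List (level B)), w ≠ [] ∧ IsPath θ w ∧ σ ≤ θ ∧ τ ≤ θ := by
  obtain ⟨s, x, rfl⟩ : ∃ s x, w₁ = s ++ [x] := ⟨_, _, (List.dropLast_append_getLast n₁).symm⟩
  obtain ⟨y, t, rfl⟩ := List.exists_cons_of_ne_nil n₂
  obtain ⟨l, hl, hlast⟩ := exists_chain_cons (hS x y)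
  obtain ⟨ρ, hρ⟩ := exists_isPath_of_isChain (by simp) hl
  obtain ⟨σ', hσ', hσσ', -⟩ := hσ.exists_append hρ
  obtain ⟨m, hm⟩ : ∃ m, s ++ x :: l = m ++ [y] := by
    rw [← List.getLast?_eq_some_iff, List.getLast?_append, hlast]
    rfl
  rw [hm] at hσ'
  obtain ⟨θ, hθ, hσθ, hτθ⟩ := hσ'.exists_append hτ
  exact ⟨θ, _, by simp, hθ, le_iff_exists_occursAt.2 ⟨_, hσσ'.trans hσθ⟩,
    le_iff_exists_occursAt.2 ⟨_, hτθ⟩⟩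

/-- Both members extend along the common walk `W`, possibly overlapping; absence of ambiguity makes
the two extensions equal. -/
theorem JointWalks.exists_common_extension (hJ : JointWalks (factorGraph B).Adj)
    (hA : ∀ ν : level B, ¬ IsAmbiguous B ν)
    {σ τ : EqRel} {w₁ w₂ : List (level B)} (n₁ : w₁ ≠ []) (n₂ : w₂ ≠ []) (hσ : IsPath σ w₁)
    (hτ : IsPath τ w₂) :
    ∃ (θ : EqRel) (w : List (level B)), w ≠ [] ∧ IsPath θ w ∧ σ ≤ θ ∧ τ ≤ θ := by
  obtain ⟨W, hW, h₁, h₂⟩ := hJ w₁ w₂ n₁ n₂ hσ.isChain hτ.isChain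
  have hne : W ≠ [] := by
    rintro rfl
    exact n₁ (List.infix_nil.1 h₁)
  obtain ⟨θ, hθ, hσθ⟩ := hσ.exists_extension_of_infix n₁ hW h₁
  obtain ⟨θ', hθ', hτθ⟩ := hτ.exists_extension_of_infix n₂ hW h₂
  obtain rfl := hθ.eq_of_not_isAmbiguous hA hne hθ'
  exact ⟨θ, W, hne, hθ, hσθ, hτθ⟩

theorem exists_le_level_of_directedOn (hC : DirectedOn (· ≤ ·) (Av (B : Set EqRel)))
    (ν : level B) {σ : EqRel} (hσ : σ ∈ Av (B : Set EqRel)) (hl : σ.length < maxLength B) :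
    ∃ ρ ∈ level B, σ ≤ ρ := by
  obtain ⟨θ, hθ, hσθ, hνθ⟩ := hC σ hσ ν.1 ν.2.1
  obtain ⟨k, hk⟩ := le_iff_exists_occursAt.1 hσθ
  have h₁ := hk.1
  have h₂ := hνθ.length_le
  rw [length_level] at h₂
  -- A window of `θ` around the occurrence of `σ`: it starts at `k`, or ends with `θ` if there is no
  -- room.
  obtain ⟨m, hmk, hmb, hle⟩ : ∃ m ≤ k, k + σ.length ≤ m + maxLength B ∧
      m + maxLength B ≤ θ.length := by
    by_cases h : k + maxLength B ≤ θ.length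
    · exact ⟨k, le_rfl, by omega, h⟩
    · exact ⟨θ.length - maxLength B, by omega, by omega, by omega⟩
  obtain ⟨ρ, hρ, ho⟩ := exists_occursAt (maxLength_pos ν) hle
  refine ⟨ρ, ⟨mem_Av_of_le hθ (le_iff_exists_occursAt.2 ⟨_, ho⟩), hρ⟩,
    le_iff_exists_occursAt.2 ⟨k - m, OccursAt.of_add ?_ ho (by omega)⟩⟩
  rwa [Nat.add_sub_cancel' hmk]

end Main

end ConsEq

theorem theorem9p6 (B : Finset ConsEq.EqRel) (hB : B.Nonempty)
    (hlevel : (ConsEq.level B).Nonempty) :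
    ConsEq.IsAtomicSet (ConsEq.Av (B : Set ConsEq.EqRel)) ↔
      (∀ σ ∈ ConsEq.Av (B : Set ConsEq.EqRel), σ.length < ConsEq.maxLength B →
        ∃ ρ ∈ ConsEq.level B, σ ≤ ρ) ∧
      (ConsEq.StronglyConnected (ConsEq.factorGraph B) ∨
        (ConsEq.IsBicycle (ConsEq.factorGraph B) ∧
          ∀ ν : ConsEq.level B, ¬ ConsEq.IsAmbiguous B ν)) := by
  obtain ⟨ν, hν⟩ := hlevel
  rw [ConsEq.isAtomicSet_iff_directedOn (ConsEq.isLowerSet_Av _)]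
  constructor
  · intro hC
    refine ⟨fun σ hσ hl => ConsEq.exists_le_level_of_directedOn hC ⟨ν, hν⟩ hσ hl, ?_⟩
    refine or_iff_not_imp_left.2 fun hS =>
      ⟨ConsEq.isBicycle_of_jointWalks (ConsEq.jointWalks_of_directedOn hC) hS, fun κ hκ => ?_⟩
    obtain ⟨σ, τ, w, hw, hσ, hτ, hne⟩ := hκ.exists_ne
    exact hne (ConsEq.IsPath.eq_of_directedOn hC hS hw hσ hτ)
  · rintro ⟨hshort, h⟩
    refine ConsEq.directedOn_of_common_extension (ConsEq.maxLength_pos ⟨ν, hν⟩) hshort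
      fun σ τ w₁ w₂ n₁ n₂ hσ hτ => ?_
    by_cases hS : ConsEq.StronglyConnected (ConsEq.factorGraph B)
    · exact hS.exists_common_extension n₁ n₂ hσ hτ
    · obtain ⟨hG, hA⟩ := h.resolve_left hS
      obtain ⟨p, q, hpq⟩ := hG.exists_isPivot hS
      exact hpq.jointWalks.exists_common_extension hA n₁ n₂ hσ hτ
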